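/- Let $\mathbb T=\mathbb R/2\pi\mathbb Z$, let $K>0$, $T\ge 0$, and let $\mathcal M(X)$ denote the finite nonnegative Borel (Radon) measures on $X$, for $X=\mathbb T\times\mathbb R$ or $X=\mathbb R$. Let $\mathcal S=\mathcal S(X)$ be the set of $h:X\to\mathbb R$ with $\max\{\|h\|_{\infty},\mathrm{Lip}(h)\}\le 1$ (Lipschitz constants with respect to the Euclidean distance), and let $d(\mu,\nu)=\sup_{h\in\mathcal S}|\int h\,d\mu-\int h\,d\nu|$ be the bounded Lipschitz distance on $\mathcal M(X)$. Nonnegative integrable functions are identified with measures through their densities with respect to Lebesgue measure. A *measure-valued solution* on $[0,T]$ of the continuum Kuramoto equation $\partial_t\mu+\partial_\theta(u\mu)=0$ is a family $\mu_t\in\mathcal M(\mathbb T\times\mathbb R)$, $t\in[0,T]$, such that $t\mapsto\int h\,d\mu_t$ is continuous on $[0,T]$ for every $h\in C_0(\mathbb T\times\mathbb R)$ and $$\int h(\cdot,\cdot,t)\,d\mu_t-\int h(\cdot,\cdot,0)\,d\mu_0=\int_0^t\!\int\big(\partial_s h+u\,\partial_\theta h\big)\,d\mu_s\,ds\qquad(0\le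 t<T)$$ for every compactly supported $C^1$ function $h$ on $\mathbb T\times\mathbb R\times[0,T)$. For a frequency distribution with density $g$, the velocity is $$u(\theta,\omega,t)=\omega-K\int_{\mathbb T\times\mathbb R}\sin(\theta-\theta_*)\,g(\omega_*)\,\mu_t(d\theta_*,d\omega_*).$$ For a frequency distribution $\gamma\in\mathcal M(\mathbb R)$ and $\mu_t=\rho(\theta,\omega,t)\,d\theta\,d\omega$ with a nonnegative density $\rho(\cdot,\cdot,t)$ that is continuous on $\mathbb T\times\mathbb R$ for each $t$, it is $$u(\theta,\omega,t)=\omega-K\int_{\mathbb T\times\mathbb R}\sin(\theta-\theta_*)\,\rho(\theta_*,\omega_*,t)\,d\theta_*\,\gamma(d\omega_*);$$ $\rho$ is then called a *solution with frequency distribution $\gamma$*. **Proposition.** For every $M\in\mathbb R$ there is a constant $C>0$ depending only on $K$, $T$ and $M$ with the following property. Let $g\in\mathcal S(\mathbb R)$ with $g\ge0$ and $\int_{\mathbb R}g\,d\omega=1$, and let $\mu$ be a measure-valued solution on $[0,T]$ with frequency density $g$ and initial datum $\mu_0\in\mathcal M(\mathbb T\times\mathbb R)$, $\mu_0(\mathbb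 T\times\mathbb R)\le M$. For $n\in\mathbb N$ let $g^n\in\mathcal M(\mathbb R)$ and let $\rho^n$ be a solution on $[0,T]$ with frequency distribution $g^n$ and initial datum $\rho^n_0\in\mathcal S(\mathbb T\times\mathbb R)$. Define the order parameters $$r(t)=\Big|\int_{\mathbb T\times\mathbb R} e^{i\theta}g(\omega)\,\mu_t(d\theta,d\omega)\Big|,\qquad r^n(t)=\Big|\int_{\mathbb T\times\mathbb R} e^{i\theta}\rho^n(\theta,\omega,t)\,d\theta\,g^n(d\omega)\Big| .$$ Then $$|r^n(t)-r(t)|\le C\big(d(g^n,g)+d(\rho^n_0,\mu_0)\big)\qquad\text{for all } n \text{ and all } t\in[0,T].$$ In particular, if $d(g^n,g)\to0$ and $d(\rho^n_0,\mu_0)\to0$ as $n\to\infty$, then $r^n(t)\to r(t)$ for every $t\in[0,T]$. -/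

import Mathlib

open Real Set Filter Topology MeasureTheory
open scoped ZeroAtInfty

namespace Kuramoto

noncomputable section

/-- The period of the torus is positive. -/
instance twoPiPos : Fact (0 < 2 * π) := ⟨Real.two_pi_pos⟩

/-- The torus `𝕋 = ℝ / 2πℤ`. Its distance is the arc-length distance and its volume is the
Lebesgue measure `dθ`, of total mass `2π`. -/
abbrev Torus : Type := AddCircle (2 * π)

/-- The phase space `𝕋 × ℝ` of pairs `(θ, ω)`. -/
abbrev Phase : Type := Torus × ℝ

/-- The Euclidean distance `|(θ, ω) - (θ', ω')|` on `𝕋 × ℝ`. -/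
def phaseDist (p q : Phase) : ℝ := √(dist p.1 q.1 ^ 2 + dist p.2 q.2 ^ 2)

/-- The admissible set `𝒮` of real functions `h` with `max {‖h‖_∞, Lip h} ≤ 1`, where the Lipschitz
constant is taken with respect to the distance `δ`. -/
def admissible {X : Type*} (δ : X → X → ℝ) : Set (X → ℝ) :=
  {h | (∀ x, |h x| ≤ 1) ∧ ∀ x y, |h x - h y| ≤ δ x y}

/-- The bounded Lipschitz distance `d(μ, ν) = sup_{h ∈ 𝒮} |⟨μ, h⟩ - ⟨ν, h⟩|` of finite measures. -/
def blDist {X : Type*} [MeasurableSpace X] (δ : X → X → ℝ) (μ ν : Measure X) : ℝ :=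
  ⨆ h : admissible δ, |(∫ x, h.1 x ∂μ) - ∫ x, h.1 x ∂ν|

/-- The bounded Lipschitz distance on `𝕋 × ℝ`. -/
def phaseBL (μ ν : Measure Phase) : ℝ := blDist phaseDist μ ν

/-- The bounded Lipschitz distance on `ℝ`. -/
def freqBL (μ ν : Measure ℝ) : ℝ := blDist (fun x y : ℝ => dist x y) μ ν

/-- The measure `f(x) m(dx)` with nonnegative real density `f` with respect to `m`. -/
def densityMeasure {X : Type*} [MeasurableSpace X] (m : Measure X) (f : X → ℝ) : Measure X :=
  m.withDensity fun x => ENNReal.ofReal (f x)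

/-- The mean-field velocity `ω - K ∫ sin (θ - θ') σ(dθ', dω')` generated by the weighted
measure `σ` at one time; `σ` is `g(ω) μ_t(dθ, dω)` when the frequencies have a density `g`, and
`ρ(θ, ω, t) dθ γ(dω)` when they are distributed according to a measure `γ`. -/
def velocity (K : ℝ) (σ : Measure Phase) (θ : Torus) (ω : ℝ) : ℝ :=
  ω - K * ∫ p : Phase, Real.Angle.sin (θ - p.1) ∂σ

/-- The order parameter `r ≥ 0` with `r e^{iφ} = ∫ e^{iθ} σ(dθ, dω)`, for the weighted
measure `σ` at one time. -/
def orderParameter (σ : Measure Phase) : ℝ :=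
  ‖∫ p : Phase, (Real.Angle.toCircle p.1 : ℂ) ∂σ‖

/-- `C¹` test functions `h(θ, ω, t)` with compact support in `𝕋 × ℝ × [0, T)`. They are given as
`C¹` functions on `𝕋 × ℝ × ℝ` with compact support in `𝕋 × ℝ × (-∞, T)`; only their
restrictions to times in `[0, T)` are used. -/
structure IsTestFunction (T : ℝ) (h : Torus → ℝ → ℝ → ℝ) : Prop where
  contDiff : ContDiff ℝ 1 fun q : ℝ × ℝ × ℝ => h (q.1 : Torus) q.2.1 q.2.2
  compactSupport : HasCompactSupport fun q : Torus × ℝ × ℝ => h q.1 q.2.1 q.2.2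
  support_lt : tsupport (fun q : Torus × ℝ × ℝ => h q.1 q.2.1 q.2.2) ⊆ {q | q.2.2 < T}

/-- The derivative `∂_θ h (θ, ω, t)`. -/
def dTheta (h : Torus → ℝ → ℝ → ℝ) (θ : Torus) (ω t : ℝ) : ℝ :=
  deriv (fun x : ℝ => h (θ + (x : Torus)) ω t) 0

/-- The derivative `∂_t h (θ, ω, t)`. -/
def dTime (h : Torus → ℝ → ℝ → ℝ) (θ : Torus) (ω t : ℝ) : ℝ :=
  deriv (fun s : ℝ => h θ ω s) t

/-- `μ` is a weakly continuous curve of finite measures on `[0, T]` that solves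
`∂_t μ + ∂_θ (u μ) = 0` in the weak sense, where `u` is the mean-field velocity generated by the
weighted measures `σ t`. -/
structure IsWeakSolution (K T : ℝ) (μ σ : ℝ → Measure Phase) : Prop where
  finite : ∀ t ∈ Icc 0 T, IsFiniteMeasure (μ t)
  weaklyContinuous : ∀ h : C₀(Phase, ℝ), ContinuousOn (fun t => ∫ p, h p ∂(μ t)) (Icc 0 T)
  weakEquation : ∀ h : Torus → ℝ → ℝ → ℝ, IsTestFunction T h → ∀ t ∈ Ico 0 T,
    (∫ p, h p.1 p.2 t ∂(μ t)) - ∫ p, h p.1 p.2 0 ∂(μ 0) =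
      ∫ s in (0 : ℝ)..t, ∫ p, (dTime h p.1 p.2 s +
        velocity K (σ s) p.1 p.2 * dTheta h p.1 p.2 s) ∂(μ s)

/-- The weighted measure `g(ω) μ(dθ, dω)`. -/
def weightByDensity (g : ℝ → ℝ) (μ : Measure Phase) : Measure Phase :=
  densityMeasure μ fun p => g p.2

/-- The weighted measure `ρ(θ, ω) dθ γ(dω)`. -/
def weightByMeasure (γ : Measure ℝ) (ρ : Phase → ℝ) : Measure Phase :=
  densityMeasure ((volume : Measure Torus).prod γ) ρ

/-- Measure-valued solutions of the continuum Kuramoto equation on `[0, T]` with coupling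
strength `K` and frequency density `g`; the initial datum is `μ 0`. -/
def IsMeasureSolution (K T : ℝ) (g : ℝ → ℝ) (μ : ℝ → Measure Phase) : Prop :=
  IsWeakSolution K T μ fun t => weightByDensity g (μ t)

/-- Solutions of the continuum Kuramoto equation on `[0, T]` whose frequency distribution is a
measure `γ` on `ℝ`; the initial datum is `ρ 0`. The product `ρ(θ, ω, t) γ(dω)` needs the values of
the density at each `ω`, so `ρ t` is the continuous version of the density of the measure-valued
solution `ρ(θ, ω, t) dθ dω`. -/
structure IsDensitySolution (K T : ℝ) (γ : Measure ℝ) (ρ : ℝ → Phase → ℝ) : Prop where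
  continuous : ∀ t ∈ Icc 0 T, Continuous (ρ t)
  nonneg : ∀ t ∈ Icc 0 T, ∀ p, 0 ≤ ρ t p
  weak : IsWeakSolution K T (fun t => densityMeasure volume (ρ t))
    fun t => weightByMeasure γ (ρ t)

end

end Kuramoto

namespace Kuramoto

noncomputable section

/-- The cosine on the torus. -/
def torusCos (θ : Torus) : ℝ := Real.Angle.cos θ

/-- The sine on the torus. -/
def torusSin (θ : Torus) : ℝ := Real.Angle.sin θ

lemma torusCos_coe (x : ℝ) : torusCos (x : Torus) = Real.cos x := Real.Angle.cos_coe x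

lemma torusSin_coe (x : ℝ) : torusSin (x : Torus) = Real.sin x := Real.Angle.sin_coe x

lemma continuous_torusCos : Continuous torusCos := Real.Angle.continuous_cos

lemma continuous_torusSin : Continuous torusSin := Real.Angle.continuous_sin

lemma exists_coe_eq (θ : Torus) : ∃ x : ℝ, (x : Torus) = θ := QuotientAddGroup.mk_surjective θ

lemma abs_torusCos_le (θ : Torus) : |torusCos θ| ≤ 1 := by
  obtain ⟨x, rfl⟩ := exists_coe_eq θ
  rw [torusCos_coe]; exact Real.abs_cos_le_one x

lemma abs_torusSin_le (θ : Torus) : |torusSin θ| ≤ 1 := by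
  obtain ⟨x, rfl⟩ := exists_coe_eq θ
  rw [torusSin_coe]; exact Real.abs_sin_le_one x

lemma angle_sin_sub (θ η : Torus) :
    Real.Angle.sin (θ - η) = torusSin θ * torusCos η - torusCos θ * torusSin η := by
  obtain ⟨x, rfl⟩ := exists_coe_eq θ
  obtain ⟨y, rfl⟩ := exists_coe_eq η
  rw [torusCos_coe, torusSin_coe, torusCos_coe, torusSin_coe, ← Real.sin_sub]
  exact Real.Angle.sin_coe (x - y)

lemma exists_coe_dist (θ η : Torus) :
    ∃ x y : ℝ, (x : Torus) = θ ∧ (y : Torus) = η ∧ |x - y| = dist θ η := by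
  obtain ⟨x, rfl⟩ := exists_coe_eq θ
  obtain ⟨y, rfl⟩ := exists_coe_eq η
  refine ⟨x - round ((2 * π)⁻¹ * (x - y)) * (2 * π), y, ?_, rfl, ?_⟩
  · rw [AddCircle.coe_sub, sub_eq_self, AddCircle.coe_eq_zero_iff]
    exact ⟨round ((2 * π)⁻¹ * (x - y)), by rw [zsmul_eq_mul]⟩
  · rw [dist_eq_norm, ← AddCircle.coe_sub, AddCircle.norm_eq]
    congr 1; ring

/-- The mean field cosine component of a measure. -/
def cosMean (σ : Measure Phase) : ℝ := ∫ p : Phase, torusCos p.1 ∂σ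

/-- The mean field sine component of a measure. -/
def sinMean (σ : Measure Phase) : ℝ := ∫ p : Phase, torusSin p.1 ∂σ

lemma integrable_of_continuous_bounded {X : Type*} [TopologicalSpace X] [MeasurableSpace X]
    [OpensMeasurableSpace X] {σ : Measure X} [IsFiniteMeasure σ] {f : X → ℝ}
    (hf : Continuous f) {C : ℝ} (hC : ∀ x, |f x| ≤ C) : Integrable f σ :=
  Integrable.of_bound hf.measurable.aestronglyMeasurable C (Eventually.of_forall hC)

lemma abs_integral_le_of_bound {X : Type*} [MeasurableSpace X] {σ : Measure X} [IsFiniteMeasure σ]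
    {f : X → ℝ} {C : ℝ} (hC : ∀ x, |f x| ≤ C) : |∫ x, f x ∂σ| ≤ C * σ.real univ := by
  have := norm_integral_le_of_norm_le_const (μ := σ) (f := f) (C := C) (Eventually.of_forall hC)
  simpa using this

lemma velocity_eq (K : ℝ) (σ : Measure Phase) [IsFiniteMeasure σ] (θ : Torus) (ω : ℝ) :
    velocity K σ θ ω = ω - K * (cosMean σ * torusSin θ - sinMean σ * torusCos θ) := by
  have hc : Integrable (fun p : Phase => torusCos p.1) σ :=
    integrable_of_continuous_bounded (continuous_torusCos.comp continuous_fst)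
      (fun p => abs_torusCos_le p.1)
  have hs : Integrable (fun p : Phase => torusSin p.1) σ :=
    integrable_of_continuous_bounded (continuous_torusSin.comp continuous_fst)
      (fun p => abs_torusSin_le p.1)
  have : ∫ p : Phase, Real.Angle.sin (θ - p.1) ∂σ =
      cosMean σ * torusSin θ - sinMean σ * torusCos θ := by
    rw [show (fun p : Phase => Real.Angle.sin (θ - p.1)) =
      fun p : Phase => torusSin θ * torusCos p.1 - torusCos θ * torusSin p.1 from
        funext fun p => angle_sin_sub θ p.1]
    rw [integral_sub (hc.const_mul _) (hs.const_mul _), integral_const_mul, integral_const_mul]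
    simp only [cosMean, sinMean]; ring
  rw [velocity, this]

lemma abs_orderParameter_sub_le (σ τ : Measure Phase) [IsFiniteMeasure σ] [IsFiniteMeasure τ] :
    |orderParameter σ - orderParameter τ| ≤
      |cosMean σ - cosMean τ| + |sinMean σ - sinMean τ| := by
  have key : ∀ (ν : Measure Phase) [IsFiniteMeasure ν],
      ∫ p : Phase, (Real.Angle.toCircle p.1 : ℂ) ∂ν = cosMean ν + sinMean ν * Complex.I := by
    intro ν _
    have hc : Integrable (fun p : Phase => torusCos p.1) ν :=
      integrable_of_continuous_bounded (continuous_torusCos.comp continuous_fst)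
        (fun p => abs_torusCos_le p.1)
    have hs : Integrable (fun p : Phase => torusSin p.1) ν :=
      integrable_of_continuous_bounded (continuous_torusSin.comp continuous_fst)
        (fun p => abs_torusSin_le p.1)
    rw [show (fun p : Phase => (Real.Angle.toCircle p.1 : ℂ)) =
      fun p : Phase => ((torusCos p.1 : ℝ) : ℂ) + ((torusSin p.1 : ℝ) : ℂ) * Complex.I from
        funext fun p => Real.Angle.coe_toCircle p.1]
    rw [integral_add hc.ofReal (hs.ofReal.mul_const _), integral_mul_const,
      integral_complex_ofReal, integral_complex_ofReal]
    rfl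
  rw [orderParameter, orderParameter, key σ, key τ]
  refine (abs_norm_sub_norm_le _ _).trans ?_
  rw [show (cosMean σ + sinMean σ * Complex.I - (cosMean τ + sinMean τ * Complex.I) : ℂ) =
    ((cosMean σ - cosMean τ : ℝ) : ℂ) + ((sinMean σ - sinMean τ : ℝ) : ℂ) * Complex.I by
      push_cast; ring]
  refine (norm_add_le _ _).trans ?_
  simp [-Complex.ofReal_sub]

lemma orderParameter_nonneg (σ : Measure Phase) : 0 ≤ orderParameter σ := norm_nonneg _

lemma orderParameter_le (σ : Measure Phase) [IsFiniteMeasure σ] :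
    orderParameter σ ≤ σ.real univ := by
  have := norm_integral_le_of_norm_le_const (μ := σ)
    (f := fun p : Phase => (Real.Angle.toCircle p.1 : ℂ)) (C := 1)
    (Eventually.of_forall fun p => (Circle.norm_coe _).le)
  simpa [orderParameter] using this

lemma abs_cosMean_le (σ : Measure Phase) [IsFiniteMeasure σ] : |cosMean σ| ≤ σ.real univ := by
  simpa [cosMean] using abs_integral_le_of_bound (σ := σ) (fun p : Phase => abs_torusCos_le p.1)

lemma abs_sinMean_le (σ : Measure Phase) [IsFiniteMeasure σ] : |sinMean σ| ≤ σ.real univ := by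
  simpa [sinMean] using abs_integral_le_of_bound (σ := σ) (fun p : Phase => abs_torusSin_le p.1)

lemma dist_fst_le_phaseDist (p q : Phase) : dist p.1 q.1 ≤ phaseDist p q :=
  Real.le_sqrt_of_sq_le (by nlinarith [sq_nonneg (dist p.2 q.2)])

lemma dist_snd_le_phaseDist (p q : Phase) : dist p.2 q.2 ≤ phaseDist p q :=
  Real.le_sqrt_of_sq_le (by nlinarith [sq_nonneg (dist p.1 q.1)])

lemma blDist_nonneg {X : Type*} [MeasurableSpace X] (δ : X → X → ℝ) (μ ν : Measure X) :
    0 ≤ blDist δ μ ν := Real.iSup_nonneg fun _ => abs_nonneg _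

lemma abs_integral_sub_le_blDist {X : Type*} [MeasurableSpace X] {δ : X → X → ℝ}
    {μ ν : Measure X} [IsFiniteMeasure μ] [IsFiniteMeasure ν] {f : X → ℝ} {L : ℝ} (hL : 0 < L)
    (hb : ∀ x, |f x| ≤ L) (hl : ∀ x y, |f x - f y| ≤ L * δ x y) :
    |(∫ x, f x ∂μ) - ∫ x, f x ∂ν| ≤ L * blDist δ μ ν := by
  have hmem : (fun x => L⁻¹ * f x) ∈ admissible δ := by
    refine ⟨fun x => ?_, fun x y => ?_⟩
    · rw [abs_mul, abs_of_pos (inv_pos.2 hL), inv_mul_le_iff₀ hL]; simpa using hb x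
    · rw [← mul_sub, abs_mul, abs_of_pos (inv_pos.2 hL), inv_mul_le_iff₀ hL]; exact hl x y
  have hbdd : BddAbove (range fun h : admissible δ => |(∫ x, h.1 x ∂μ) - ∫ x, h.1 x ∂ν|) := by
    refine ⟨μ.real univ + ν.real univ, ?_⟩
    rintro _ ⟨h, rfl⟩
    have h1 := abs_integral_le_of_bound (σ := μ) h.2.1
    have h2 := abs_integral_le_of_bound (σ := ν) h.2.1
    rw [one_mul] at h1 h2
    exact (abs_sub _ _).trans (add_le_add h1 h2)
  have := le_ciSup hbdd ⟨_, hmem⟩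
  simp only [integral_const_mul, ← mul_sub, abs_mul, abs_of_pos (inv_pos.2 hL)] at this
  rw [inv_mul_le_iff₀ hL] at this
  exact this

lemma continuous_of_continuous_lift {Y : Type*} [TopologicalSpace Y] {f : Torus → ℝ → Y}
    (hf : Continuous fun q : ℝ × ℝ => f (q.1 : Torus) q.2) :
    Continuous fun p : Phase => f p.1 p.2 := by
  have h : IsOpenQuotientMap (Prod.map (QuotientAddGroup.mk : ℝ → Torus) (id : ℝ → ℝ)) :=
    QuotientAddGroup.isOpenQuotientMap_mk.prodMap IsOpenQuotientMap.id
  exact h.continuous_comp_iff.1 hf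

lemma isTestFunction_mul {f : Torus → ℝ → ℝ} {χ : ℝ → ℝ} {R r T : ℝ}
    (hf : ContDiff ℝ 1 fun q : ℝ × ℝ => f (q.1 : Torus) q.2)
    (hR : ∀ θ ω, R < |ω| → f θ ω = 0) (hχ : ContDiff ℝ 1 χ) (hrT : r < T)
    (hr : ∀ s, r < |s| → χ s = 0) : IsTestFunction T fun θ ω s => f θ ω * χ s := by
  have hsupp : ∀ q : Torus × ℝ × ℝ,
      q ∉ (univ : Set Torus) ×ˢ (Metric.closedBall (0 : ℝ) R ×ˢ Metric.closedBall (0 : ℝ) r) →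
      f q.1 q.2.1 * χ q.2.2 = 0 := by
    rintro ⟨θ, ω, s⟩ hq
    by_cases h1 : R < |ω|
    · simp [hR θ ω h1]
    by_cases h2 : r < |s|
    · simp [hr s h2]
    · exact absurd (by simpa [Real.norm_eq_abs] using ⟨not_lt.1 h1, not_lt.1 h2⟩) hq
  refine ⟨?_, ?_, ?_⟩
  · have h1 : ContDiff ℝ 1 fun q : ℝ × ℝ × ℝ => f (q.1 : Torus) q.2.1 :=
      hf.comp (contDiff_fst.prodMk (contDiff_fst.comp contDiff_snd))
    exact h1.mul (hχ.comp (contDiff_snd.comp contDiff_snd))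
  · exact HasCompactSupport.intro (isCompact_univ.prod
      ((isCompact_closedBall _ _).prod (isCompact_closedBall _ _))) hsupp
  · have hcl : IsClosed {q : Torus × ℝ × ℝ | q.2.2 ≤ r} :=
      isClosed_le (by fun_prop) continuous_const
    refine (closure_minimal (fun q hq => ?_) hcl).trans fun q hq => lt_of_le_of_lt hq hrT
    by_contra hlt
    simp only [mem_ofPred_eq, not_le] at hlt
    refine hq (hsupp q fun hm => ?_)
    have := hm.2.2
    simp only [Metric.mem_closedBall, dist_zero_right, Real.norm_eq_abs] at this
    exact absurd (le_abs_self q.2.2) (by linarith)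

lemma dTheta_eq {h : Torus → ℝ → ℝ → ℝ} {f' : Torus → ℝ → ℝ → ℝ}
    (hd : ∀ (x ω s : ℝ), HasDerivAt (fun y : ℝ => h (y : Torus) ω s) (f' (x : Torus) ω s) x)
    (θ : Torus) (ω s : ℝ) : dTheta h θ ω s = f' θ ω s := by
  obtain ⟨x, rfl⟩ := exists_coe_eq θ
  have h1 : HasDerivAt (fun y : ℝ => h ((x + y : ℝ) : Torus) ω s) (f' (x : Torus) ω s) 0 := by
    have := hd x ω s
    rw [← add_zero x] at this
    simpa using this.comp_const_add x 0
  simpa [dTheta, AddCircle.coe_add] using h1.deriv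

lemma exists_time_cutoff {t T : ℝ} (ht : t ∈ Ico 0 T) :
    ∃ (χ : ℝ → ℝ) (r : ℝ), ContDiff ℝ 1 χ ∧ r < T ∧ (∀ s, r < |s| → χ s = 0) ∧
      ∀ s ∈ Icc 0 t, χ =ᶠ[𝓝 s] 1 := by
  obtain ⟨h0, hT⟩ := ht
  let b : ContDiffBump (0 : ℝ) := ⟨(2 * t + T) / 3, (t + 2 * T) / 3, by linarith, by linarith⟩
  refine ⟨b, (t + 2 * T) / 3, b.contDiff, by linarith, fun s hs => ?_, fun s hs => ?_⟩
  · exact b.zero_of_le_dist (by simpa [b] using hs.le)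
  · refine b.eventuallyEq_one_of_mem_ball ?_
    simp only [Metric.mem_ball, dist_zero_right, Real.norm_eq_abs, abs_of_nonneg hs.1, b]
    linarith [hs.2]

/-- A smooth cutoff on `ℝ` that equals one on `[-(n+1), n+1]`. -/
def freqCutoff (n : ℕ) : ContDiffBump (0 : ℝ) := ⟨n + 1, n + 2, by positivity, by linarith⟩

lemma freqCutoff_eq_zero (n : ℕ) {ω : ℝ} (h : (n : ℝ) + 2 < |ω|) : freqCutoff n ω = 0 :=
  (freqCutoff n).zero_of_le_dist (by simpa [freqCutoff] using h.le)

lemma tendsto_freqCutoff (ω : ℝ) : Tendsto (fun n => freqCutoff n ω) atTop (𝓝 1) := by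
  refine tendsto_const_nhds.congr' ?_
  obtain ⟨N, hN⟩ := exists_nat_ge |ω|
  filter_upwards [eventually_ge_atTop N] with n hn
  refine ((freqCutoff n).one_of_mem_closedBall ?_).symm
  have : (N : ℝ) ≤ n := by exact_mod_cast hn
  simp only [Metric.mem_closedBall, dist_zero_right, Real.norm_eq_abs, freqCutoff]
  linarith

lemma abs_freqCutoff_le (n : ℕ) (ω : ℝ) : |freqCutoff n ω| ≤ 1 := by
  rw [abs_of_nonneg (freqCutoff n).nonneg]; exact (freqCutoff n).le_one

lemma tendsto_integral_mul_freqCutoff (ν : Measure Phase) [IsFiniteMeasure ν] {ψ : Phase → ℝ}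
    (hψ : Continuous ψ) {Q : ℝ} (hQ : ∀ p, |ψ p| ≤ Q) :
    Tendsto (fun n => ∫ p, ψ p * freqCutoff n p.2 ∂ν) atTop (𝓝 (∫ p, ψ p ∂ν)) := by
  refine tendsto_integral_of_dominated_convergence (fun _ => Q) (fun n => ?_)
    (integrable_const _) (fun n => Eventually.of_forall fun p => ?_)
    (Eventually.of_forall fun p => ?_)
  · exact (hψ.mul ((freqCutoff n).continuous.comp continuous_snd)).aestronglyMeasurable
  · rw [Real.norm_eq_abs, abs_mul]
    exact (mul_le_of_le_one_right (abs_nonneg _) (abs_freqCutoff_le n p.2)).trans (hQ p)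
  · simpa using (tendsto_freqCutoff p.2).const_mul (ψ p)

section WeakSolution

variable {K T : ℝ} {μ σ : ℝ → Measure Phase}

lemma IsWeakSolution.continuousOn_of_support (h : IsWeakSolution K T μ σ) {ψ : Phase → ℝ}
    (hψ : Continuous ψ) {R : ℝ} (hR : ∀ p, R < |p.2| → ψ p = 0) :
    ContinuousOn (fun t => ∫ p, ψ p ∂(μ t)) (Icc 0 T) := by
  have hc : HasCompactSupport ψ := HasCompactSupport.intro
    (isCompact_univ.prod (isCompact_closedBall (0 : ℝ) R)) fun p hp => hR p <| by
      by_contra hlt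
      exact hp (by simpa [mem_prod, Real.norm_eq_abs] using not_lt.1 hlt)
  exact h.weaklyContinuous ⟨⟨ψ, hψ⟩, hc.is_zero_at_infty⟩

lemma IsWeakSolution.integral_sub_integral_zero (h : IsWeakSolution K T μ σ)
    {f f' : Torus → ℝ → ℝ} (hf : ContDiff ℝ 1 fun q : ℝ × ℝ => f (q.1 : Torus) q.2)
    {R : ℝ} (hR : ∀ θ ω, R < |ω| → f θ ω = 0)
    (hd : ∀ x ω : ℝ, HasDerivAt (fun y : ℝ => f (y : Torus) ω) (f' (x : Torus) ω) x)
    {t : ℝ} (ht : t ∈ Ico 0 T) :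
    (∫ p, f p.1 p.2 ∂(μ t)) - ∫ p, f p.1 p.2 ∂(μ 0) =
      ∫ s in (0 : ℝ)..t, ∫ p, velocity K (σ s) p.1 p.2 * f' p.1 p.2 ∂(μ s) := by
  obtain ⟨χ, r, hχ, hr, hχ0, hχ1⟩ := exists_time_cutoff ht
  have := h.weakEquation _ (isTestFunction_mul hf hR hχ hr hχ0) t ht
  have e0 : χ 0 = 1 := (hχ1 0 ⟨le_rfl, ht.1⟩).self_of_nhds
  have et : χ t = 1 := (hχ1 t ⟨ht.1, le_rfl⟩).self_of_nhds
  simp only [e0, et, mul_one] at this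
  rw [this]
  refine intervalIntegral.integral_congr fun s hs => ?_
  rw [uIcc_of_le ht.1] at hs
  refine integral_congr_ae (Eventually.of_forall fun p => ?_)
  have e1 : dTime (fun θ ω s => f θ ω * χ s) p.1 p.2 s = 0 := by
    have : (fun s => f p.1 p.2 * χ s) =ᶠ[𝓝 s] fun _ => f p.1 p.2 := by
      filter_upwards [hχ1 s hs] with u hu
      simp [hu]
    rw [dTime, this.deriv_eq, deriv_const]
  have e2 : dTheta (fun θ ω s => f θ ω * χ s) p.1 p.2 s = f' p.1 p.2 * χ s :=
    dTheta_eq (f' := fun θ ω s => f' θ ω * χ s) (fun x ω s => (hd x ω).mul_const _) _ _ _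
  have es : χ s = 1 := (hχ1 s hs).self_of_nhds
  simp only [e1, e2, es, mul_one, zero_add]

lemma Icc_subset_closure_Ico {T : ℝ} (hT : 0 < T) : Icc 0 T ⊆ closure (Ico 0 T) := by
  rw [closure_Ico hT.ne]

lemma IsWeakSolution.integral_freq_eq (h : IsWeakSolution K T μ σ) {φ : ℝ → ℝ}
    (hφ : ContDiff ℝ 1 φ) {R : ℝ} (hR : ∀ ω, R < |ω| → φ ω = 0) {t : ℝ} (ht : t ∈ Icc 0 T) :
    ∫ p, φ p.2 ∂(μ t) = ∫ p, φ p.2 ∂(μ 0) := by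
  rcases (ht.1.trans ht.2).eq_or_lt with hT | hT
  · rw [show t = 0 from le_antisymm (hT ▸ ht.2) ht.1]
  have hc : ContinuousOn (fun t => ∫ p, φ p.2 ∂(μ t)) (Icc 0 T) :=
    h.continuousOn_of_support (ψ := fun p => φ p.2) (hφ.continuous.comp continuous_snd)
      fun p hp => hR p.2 hp
  have heq : EqOn (fun t => ∫ p, φ p.2 ∂(μ t)) (fun _ => ∫ p, φ p.2 ∂(μ 0)) (Ico 0 T) := by
    intro t ht
    have := h.integral_sub_integral_zero (f := fun _ ω => φ ω) (f' := fun _ _ => 0)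
      (hφ.comp contDiff_snd) (fun _ => hR) (fun x ω => hasDerivAt_const _ _) ht
    simpa [sub_eq_zero] using this
  exact heq.of_subset_closure hc continuousOn_const Ico_subset_Icc_self
    (Icc_subset_closure_Ico hT) ht

lemma IsWeakSolution.measure_univ_eq (h : IsWeakSolution K T μ σ) {t : ℝ} (ht : t ∈ Icc 0 T) :
    (μ t).real univ = (μ 0).real univ := by
  have key : ∀ s ∈ Icc 0 T, Tendsto (fun n => ∫ p, freqCutoff n p.2 ∂(μ s)) atTop
      (𝓝 ((μ s).real univ)) := by
    intro s hs
    have := h.finite s hs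
    simpa using tendsto_integral_mul_freqCutoff (μ s) (ψ := fun _ => 1) continuous_const
      (Q := 1) (by simp)
  have h0 : (0 : ℝ) ∈ Icc 0 T := ⟨le_rfl, ht.1.trans ht.2⟩
  refine tendsto_nhds_unique (key t ht) ((key 0 h0).congr fun n => ?_)
  exact (h.integral_freq_eq (freqCutoff n).contDiff
    (fun ω hω => freqCutoff_eq_zero n hω) ht).symm

lemma IsWeakSolution.continuousOn_integral (h : IsWeakSolution K T μ σ) {ψ : Phase → ℝ}
    (hψ : Continuous ψ) {Q : ℝ} (hQ : ∀ p, |ψ p| ≤ Q) :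
    ContinuousOn (fun t => ∫ p, ψ p ∂(μ t)) (Icc 0 T) := by
  by_cases hT : 0 ≤ T
  swap
  · rw [Icc_eq_empty hT]; exact continuousOn_empty _
  have h0 : (0 : ℝ) ∈ Icc 0 T := ⟨le_rfl, hT⟩
  have hfin0 := h.finite 0 h0
  have hunif : TendstoUniformlyOn (fun n t => ∫ p, ψ p * freqCutoff n p.2 ∂(μ t))
      (fun t => ∫ p, ψ p ∂(μ t)) atTop (Icc 0 T) := by
    rw [Metric.tendstoUniformlyOn_iff]
    intro ε hε
    have hlim : Tendsto (fun n => Q * ((μ 0).real univ - ∫ p, freqCutoff n p.2 ∂(μ 0))) atTop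
        (𝓝 0) := by
      have := tendsto_integral_mul_freqCutoff (μ 0) (ψ := fun _ => 1) continuous_const
        (Q := 1) (by simp)
      have := (this.const_sub ((μ 0).real univ)).const_mul Q
      simpa using this
    filter_upwards [hlim.eventually_lt_const hε] with n hn t ht
    have := h.finite t ht
    have hcut : Continuous fun p : Phase => freqCutoff n p.2 :=
      (freqCutoff n).continuous.comp continuous_snd
    have hi : Integrable (fun p : Phase => freqCutoff n p.2) (μ t) :=
      integrable_of_continuous_bounded hcut (fun p => abs_freqCutoff_le n p.2)
    have hψi : Integrable ψ (μ t) := integrable_of_continuous_bounded hψ hQ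
    have hψc : Integrable (fun p => ψ p * freqCutoff n p.2) (μ t) :=
      integrable_of_continuous_bounded (hψ.mul hcut) (C := Q) fun p => by
        rw [abs_mul]
        exact (mul_le_of_le_one_right (abs_nonneg _) (abs_freqCutoff_le n p.2)).trans (hQ p)
    refine lt_of_le_of_lt ?_ hn
    rw [Real.dist_eq, ← integral_sub hψi hψc, ← h.measure_univ_eq ht,
      ← h.integral_freq_eq (freqCutoff n).contDiff (fun ω hω => freqCutoff_eq_zero n hω) ht]
    have e : (μ t).real univ - ∫ p, freqCutoff n p.2 ∂(μ t) =
        ∫ p, (1 - freqCutoff n p.2) ∂(μ t) := by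
      rw [integral_sub (integrable_const _) hi]; simp
    rw [e, ← integral_const_mul, ← Real.norm_eq_abs]
    refine norm_integral_le_of_norm_le (((integrable_const _).sub hi).const_mul _)
      (Eventually.of_forall fun p => ?_)
    rw [Real.norm_eq_abs, ← mul_one_sub, abs_mul,
      abs_of_nonneg (sub_nonneg.2 (freqCutoff n).le_one)]
    exact mul_le_mul_of_nonneg_right (hQ p) (sub_nonneg.2 (freqCutoff n).le_one)
  refine hunif.continuousOn (Eventually.of_forall fun n => ?_).frequently
  exact h.continuousOn_of_support (hψ.mul ((freqCutoff n).continuous.comp continuous_snd))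
    (R := n + 2) fun p hp => by simp [freqCutoff_eq_zero n hp]

end WeakSolution

/-- The rate of change of `∫ f dμ` at time `r` along the transport equation with mean field
`(C, S)`, where `f'` is the angular derivative of `f`. -/
def transportRate (K : ℝ) (μ : ℝ → Measure Phase) (C S : ℝ → ℝ) (f' : Torus → ℝ → ℝ) (r : ℝ) : ℝ :=
  (∫ p, p.2 * f' p.1 p.2 ∂(μ r)) - K * (C r * (∫ p, torusSin p.1 * f' p.1 p.2 ∂(μ r)) -
    S r * ∫ p, torusCos p.1 * f' p.1 p.2 ∂(μ r))

/-- A `C¹` observable with angular derivative `f'` bounded by `A`, that vanishes for frequencies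
larger than `R`. -/
structure IsLocalObservable (f f' : Torus → ℝ → ℝ) (R A : ℝ) : Prop where
  contDiff : ContDiff ℝ 1 fun q : ℝ × ℝ => f (q.1 : Torus) q.2
  continuous_deriv : Continuous fun p : Phase => f' p.1 p.2
  hasDerivAt : ∀ x ω : ℝ, HasDerivAt (fun y : ℝ => f (y : Torus) ω) (f' (x : Torus) ω) x
  eq_zero : ∀ θ ω, R < |ω| → f θ ω = 0
  deriv_bound : ∀ θ ω, |f' θ ω| ≤ A

lemma IsLocalObservable.deriv_eq_zero {f f' : Torus → ℝ → ℝ} {R A : ℝ}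
    (hf : IsLocalObservable f f' R A) (θ : Torus) (ω : ℝ) (hω : R < |ω|) : f' θ ω = 0 := by
  obtain ⟨x, rfl⟩ := exists_coe_eq θ
  have h1 := hf.hasDerivAt x ω
  rw [show (fun y : ℝ => f (y : Torus) ω) = fun _ => 0 from
    funext fun y => hf.eq_zero y ω hω] at h1
  exact h1.unique (hasDerivAt_const _ _)

lemma IsLocalObservable.continuous {f f' : Torus → ℝ → ℝ} {R A : ℝ}
    (hf : IsLocalObservable f f' R A) : Continuous fun p : Phase => f p.1 p.2 :=
  continuous_of_continuous_lift hf.contDiff.continuous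

lemma IsLocalObservable.abs_freq_mul_le {f f' : Torus → ℝ → ℝ} {R A : ℝ}
    (hf : IsLocalObservable f f' R A) (p : Phase) : |p.2 * f' p.1 p.2| ≤ |R| * A := by
  have hA : 0 ≤ A := (abs_nonneg _).trans (hf.deriv_bound 0 0)
  by_cases h : R < |p.2|
  · rw [hf.deriv_eq_zero _ _ h]; simp; positivity
  · rw [abs_mul]
    exact mul_le_mul ((not_lt.1 h).trans (le_abs_self R)) (hf.deriv_bound _ _) (abs_nonneg _)
      (abs_nonneg _)

lemma IsLocalObservable.abs_mul_le {f f' : Torus → ℝ → ℝ} {R A : ℝ}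
    (hf : IsLocalObservable f f' R A) {τ : Torus → ℝ} (hτ : ∀ θ, |τ θ| ≤ 1) (p : Phase) :
    |τ p.1 * f' p.1 p.2| ≤ A := by
  rw [abs_mul]
  exact (mul_le_of_le_one_left (abs_nonneg _) (hτ _)).trans (hf.deriv_bound _ _)

/-- A curve of finite measures on `[0, T]` of mass at most `M` that is transported by the velocity
`ω - K (C sin θ - S cos θ)`, with a measurable mean field `(C, S)` bounded by `B`. -/
structure IsTransported (K T B M : ℝ) (μ : ℝ → Measure Phase) (C S : ℝ → ℝ) : Prop where
  finite : ∀ t ∈ Icc 0 T, IsFiniteMeasure (μ t)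
  mass_le : ∀ t ∈ Icc 0 T, (μ t).real univ ≤ M
  continuousOn : ∀ ψ : Phase → ℝ, Continuous ψ → ∀ Q, (∀ p, |ψ p| ≤ Q) →
    ContinuousOn (fun t => ∫ p, ψ p ∂(μ t)) (Icc 0 T)
  measurable_cos : AEStronglyMeasurable C (volume.restrict (Icc 0 T))
  measurable_sin : AEStronglyMeasurable S (volume.restrict (Icc 0 T))
  abs_cos_le : ∀ t ∈ Icc 0 T, |C t| ≤ B
  abs_sin_le : ∀ t ∈ Icc 0 T, |S t| ≤ B
  weak : ∀ (f f' : Torus → ℝ → ℝ) (R A : ℝ), IsLocalObservable f f' R A → ∀ s ∈ Icc 0 T,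
    ∀ t ∈ Icc 0 T, (∫ p, f p.1 p.2 ∂(μ t)) - ∫ p, f p.1 p.2 ∂(μ s) =
      ∫ r in s..t, transportRate K μ C S f' r

lemma integrableOn_Icc_of_bound {F : ℝ → ℝ} {T B : ℝ}
    (hF : AEStronglyMeasurable F (volume.restrict (Icc 0 T))) (hB : ∀ t ∈ Icc 0 T, |F t| ≤ B) :
    IntegrableOn F (Icc 0 T) :=
  Integrable.of_bound hF B ((ae_restrict_iff' measurableSet_Icc).2 (Eventually.of_forall hB))

lemma intervalIntegrable_of_mem {F : ℝ → ℝ} {T s t : ℝ} (hF : IntegrableOn F (Icc 0 T))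
    (hs : s ∈ Icc 0 T) (ht : t ∈ Icc 0 T) : IntervalIntegrable F volume s t :=
  (hF.mono_set (uIcc_subset_Icc hs ht)).intervalIntegrable

section Transported

variable {K T B M : ℝ} {μ σ : ℝ → Measure Phase} {C S : ℝ → ℝ}

lemma integrableOn_transportRate
    (hcont : ∀ ψ : Phase → ℝ, Continuous ψ → ∀ Q, (∀ p, |ψ p| ≤ Q) →
      ContinuousOn (fun t => ∫ p, ψ p ∂(μ t)) (Icc 0 T))
    (hC : AEStronglyMeasurable C (volume.restrict (Icc 0 T)))
    (hS : AEStronglyMeasurable S (volume.restrict (Icc 0 T)))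
    (hCB : ∀ t ∈ Icc 0 T, |C t| ≤ B) (hSB : ∀ t ∈ Icc 0 T, |S t| ≤ B)
    {f f' : Torus → ℝ → ℝ} {R A : ℝ} (hf : IsLocalObservable f f' R A) :
    IntegrableOn (transportRate K μ C S f') (Icc 0 T) := by
  have h1 := hcont _ (continuous_snd.mul hf.continuous_deriv) _ hf.abs_freq_mul_le
  have h2 := hcont _ ((continuous_torusSin.comp continuous_fst).mul hf.continuous_deriv) _
    (hf.abs_mul_le abs_torusSin_le)
  have h3 := hcont _ ((continuous_torusCos.comp continuous_fst).mul hf.continuous_deriv) _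
    (hf.abs_mul_le abs_torusCos_le)
  have i2 := (integrableOn_Icc_of_bound hC hCB).mul_continuousOn h2 isCompact_Icc
  have i3 := (integrableOn_Icc_of_bound hS hSB).mul_continuousOn h3 isCompact_Icc
  exact (h1.integrableOn_Icc).sub ((i2.sub i3).const_mul K)

lemma IsTransported.integrableOn_rate (h : IsTransported K T B M μ C S)
    {f f' : Torus → ℝ → ℝ} {R A : ℝ} (hf : IsLocalObservable f f' R A) :
    IntegrableOn (transportRate K μ C S f') (Icc 0 T) :=
  integrableOn_transportRate h.continuousOn h.measurable_cos h.measurable_sin h.abs_cos_le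
    h.abs_sin_le hf

lemma integral_velocity_mul {ν τ : Measure Phase} [IsFiniteMeasure ν] [IsFiniteMeasure τ]
    {f f' : Torus → ℝ → ℝ} {R A : ℝ} (hf : IsLocalObservable f f' R A) :
    ∫ p, velocity K τ p.1 p.2 * f' p.1 p.2 ∂ν =
      (∫ p, p.2 * f' p.1 p.2 ∂ν) - K * (cosMean τ * (∫ p, torusSin p.1 * f' p.1 p.2 ∂ν) -
        sinMean τ * ∫ p, torusCos p.1 * f' p.1 p.2 ∂ν) := by
  have h1 : Integrable (fun p : Phase => p.2 * f' p.1 p.2) ν :=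
    integrable_of_continuous_bounded (continuous_snd.mul hf.continuous_deriv) hf.abs_freq_mul_le
  have h2 : Integrable (fun p : Phase => torusSin p.1 * f' p.1 p.2) ν :=
    integrable_of_continuous_bounded
      ((continuous_torusSin.comp continuous_fst).mul hf.continuous_deriv)
      (hf.abs_mul_le abs_torusSin_le)
  have h3 : Integrable (fun p : Phase => torusCos p.1 * f' p.1 p.2) ν :=
    integrable_of_continuous_bounded
      ((continuous_torusCos.comp continuous_fst).mul hf.continuous_deriv)
      (hf.abs_mul_le abs_torusCos_le)
  have h4 : Integrable (fun p : Phase => K * (cosMean τ * (torusSin p.1 * f' p.1 p.2) -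
      sinMean τ * (torusCos p.1 * f' p.1 p.2))) ν :=
    ((h2.const_mul _).sub (h3.const_mul _)).const_mul _
  rw [← integral_const_mul, ← integral_const_mul, ← integral_sub (h2.const_mul _) (h3.const_mul _),
    ← integral_const_mul, ← integral_sub h1 h4]
  refine integral_congr_ae (Eventually.of_forall fun p => ?_)
  simp only [velocity_eq]
  ring

lemma IsWeakSolution.isTransported (h : IsWeakSolution K T μ σ)
    (hσ : ∀ t ∈ Icc 0 T, IsFiniteMeasure (σ t))
    (hC : AEStronglyMeasurable (fun t => cosMean (σ t)) (volume.restrict (Icc 0 T)))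
    (hS : AEStronglyMeasurable (fun t => sinMean (σ t)) (volume.restrict (Icc 0 T)))
    (hB : ∀ t ∈ Icc 0 T, (σ t).real univ ≤ B) (hM : (μ 0).real univ ≤ M) :
    IsTransported K T B M μ (fun t => cosMean (σ t)) (fun t => sinMean (σ t)) := by
  have hcont : ∀ ψ : Phase → ℝ, Continuous ψ → ∀ Q, (∀ p, |ψ p| ≤ Q) →
      ContinuousOn (fun t => ∫ p, ψ p ∂(μ t)) (Icc 0 T) :=
    fun ψ hψ Q hQ => h.continuousOn_integral hψ hQ
  have hCB : ∀ t ∈ Icc 0 T, |cosMean (σ t)| ≤ B := fun t ht => by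
    have := hσ t ht
    exact (abs_cosMean_le _).trans (hB t ht)
  have hSB : ∀ t ∈ Icc 0 T, |sinMean (σ t)| ≤ B := fun t ht => by
    have := hσ t ht
    exact (abs_sinMean_le _).trans (hB t ht)
  refine ⟨h.finite, fun t ht => (h.measure_univ_eq ht).trans_le hM, hcont, hC, hS, hCB, hSB, ?_⟩
  intro f f' R A hf
  have hint := integrableOn_transportRate (K := K) hcont hC hS hCB hSB hf
  have key : ∀ t ∈ Icc 0 T, (∫ p, f p.1 p.2 ∂(μ t)) - ∫ p, f p.1 p.2 ∂(μ 0) =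
      ∫ r in (0 : ℝ)..t, transportRate K μ (fun t => cosMean (σ t)) (fun t => sinMean (σ t))
        f' r := by
    intro t ht
    rcases (ht.1.trans ht.2).eq_or_lt with hT | hT
    · rw [show t = 0 from le_antisymm (hT ▸ ht.2) ht.1]; simp
    have c1 : ContinuousOn (fun t => (∫ p, f p.1 p.2 ∂(μ t)) - ∫ p, f p.1 p.2 ∂(μ 0))
        (Icc 0 T) :=
      (h.continuousOn_of_support hf.continuous fun p hp => hf.eq_zero _ _ hp).sub continuousOn_const
    have c2 : ContinuousOn (fun t => ∫ r in (0 : ℝ)..t, transportRate K μ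
        (fun t => cosMean (σ t)) (fun t => sinMean (σ t)) f' r) (Icc 0 T) :=
      intervalIntegral.continuousOn_primitive_interval (by rwa [uIcc_of_le hT.le]) |>.mono
        (by rw [uIcc_of_le hT.le])
    refine EqOn.of_subset_closure (fun t ht => ?_) c1 c2 Ico_subset_Icc_self
      (Icc_subset_closure_Ico hT) ht
    refine (h.integral_sub_integral_zero hf.contDiff hf.eq_zero hf.hasDerivAt ht).trans ?_
    refine intervalIntegral.integral_congr fun s hs => ?_
    rw [uIcc_of_le ht.1] at hs
    have hs' : s ∈ Icc 0 T := ⟨hs.1, hs.2.trans ht.2.le⟩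
    have := h.finite s hs'
    have := hσ s hs'
    exact integral_velocity_mul hf
  intro s hs t ht
  have h0 : (0 : ℝ) ∈ Icc 0 T := ⟨le_rfl, ht.1.trans ht.2⟩
  have := intervalIntegral.integral_add_adjacent_intervals
    (intervalIntegrable_of_mem hint h0 hs) (intervalIntegrable_of_mem hint hs ht)
  rw [← key t ht, ← key s hs] at this
  linarith

lemma IsTransported.abs_rate_le (h : IsTransported K T B M μ C S) (hK : 0 ≤ K)
    {f f' : Torus → ℝ → ℝ} {R A : ℝ} (hf : IsLocalObservable f f' R A) {r : ℝ}
    (hr : r ∈ Icc 0 T) : |transportRate K μ C S f' r| ≤ (|R| + 2 * K * B) * A * M := by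
  have := h.finite r hr
  have hA : 0 ≤ A := (abs_nonneg _).trans (hf.deriv_bound 0 0)
  have hB : 0 ≤ B := (abs_nonneg _).trans (h.abs_cos_le r hr)
  have hM := h.mass_le r hr
  have hM0 : 0 ≤ (μ r).real univ := measureReal_nonneg
  have h1 : |∫ p, p.2 * f' p.1 p.2 ∂(μ r)| ≤ |R| * A * M :=
    (abs_integral_le_of_bound hf.abs_freq_mul_le).trans
      (mul_le_mul_of_nonneg_left hM (by positivity))
  have h2 : |∫ p, torusSin p.1 * f' p.1 p.2 ∂(μ r)| ≤ A * M :=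
    (abs_integral_le_of_bound (hf.abs_mul_le abs_torusSin_le)).trans
      (mul_le_mul_of_nonneg_left hM hA)
  have h3 : |∫ p, torusCos p.1 * f' p.1 p.2 ∂(μ r)| ≤ A * M :=
    (abs_integral_le_of_bound (hf.abs_mul_le abs_torusCos_le)).trans
      (mul_le_mul_of_nonneg_left hM hA)
  have h2' : |C r * ∫ p, torusSin p.1 * f' p.1 p.2 ∂(μ r)| ≤ B * (A * M) := by
    rw [abs_mul]; exact mul_le_mul (h.abs_cos_le r hr) h2 (abs_nonneg _) hB
  have h3' : |S r * ∫ p, torusCos p.1 * f' p.1 p.2 ∂(μ r)| ≤ B * (A * M) := by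
    rw [abs_mul]; exact mul_le_mul (h.abs_sin_le r hr) h3 (abs_nonneg _) hB
  rw [transportRate]
  refine (abs_sub _ _).trans ?_
  rw [abs_mul, abs_of_nonneg hK]
  have := mul_le_mul_of_nonneg_left ((abs_sub _ _).trans (add_le_add h2' h3')) hK
  nlinarith

lemma IsTransported.abs_integral_sub_le (h : IsTransported K T B M μ C S) (hK : 0 ≤ K)
    {f f' : Torus → ℝ → ℝ} {R A : ℝ} (hf : IsLocalObservable f f' R A) {s t : ℝ}
    (hs : s ∈ Icc 0 T) (ht : t ∈ Icc 0 T) :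
    |(∫ p, f p.1 p.2 ∂(μ t)) - ∫ p, f p.1 p.2 ∂(μ s)| ≤
      (|R| + 2 * K * B) * A * M * |t - s| := by
  rw [h.weak f f' R A hf s hs t ht, ← Real.norm_eq_abs]
  refine intervalIntegral.norm_integral_le_of_norm_le_const fun r hr => ?_
  exact h.abs_rate_le hK hf (uIcc_subset_Icc hs ht (uIoc_subset_uIcc hr))

end Transported

/-- A `C¹` observable `k`, bounded by one and `L`-Lipschitz in the frequency, with a `C¹` angular
derivative `k'` that is bounded by `A` and `A`-Lipschitz in the angle. -/
structure IsObservable (k k' : Torus → ℝ → ℝ) (A L : ℝ) : Prop where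
  contDiff : ContDiff ℝ 1 fun q : ℝ × ℝ => k (q.1 : Torus) q.2
  contDiff_deriv : ContDiff ℝ 1 fun q : ℝ × ℝ => k' (q.1 : Torus) q.2
  hasDerivAt : ∀ x ω : ℝ, HasDerivAt (fun y : ℝ => k (y : Torus) ω) (k' (x : Torus) ω) x
  abs_le_one : ∀ θ ω, |k θ ω| ≤ 1
  deriv_bound : ∀ θ ω, |k' θ ω| ≤ A
  deriv_lipschitz : ∀ x y ω : ℝ, |k' (x : Torus) ω - k' (y : Torus) ω| ≤ A * |x - y|
  freq_lipschitz : ∀ θ ω ω', |k θ ω - k θ ω'| ≤ L * |ω - ω'|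

lemma exists_angular_deriv {F : Torus → ℝ → ℝ}
    (hF : ContDiff ℝ 1 fun q : ℝ × ℝ => F (q.1 : Torus) q.2) :
    ∃ F' : Torus → ℝ → ℝ, (Continuous fun p : Phase => F' p.1 p.2) ∧
      ∀ x ω : ℝ, HasDerivAt (fun y : ℝ => F (y : Torus) ω) (F' (x : Torus) ω) x := by
  have hd : ∀ x ω : ℝ, HasDerivAt (fun y : ℝ => F (y : Torus) ω)
      (fderiv ℝ (fun q : ℝ × ℝ => F (q.1 : Torus) q.2) (x, ω) (1, 0)) x := by
    intro x ω
    have h1 := ((hF.differentiable one_ne_zero) (x, ω)).hasFDerivAt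
    exact h1.comp_hasDerivAt (f := fun y : ℝ => (y, ω)) x
      ((hasDerivAt_id x).prodMk (hasDerivAt_const x ω))
  have heq : ∀ x ω : ℝ, deriv (fun y : ℝ => F ((x : Torus) + (y : Torus)) ω) 0 =
      fderiv ℝ (fun q : ℝ × ℝ => F (q.1 : Torus) q.2) (x, ω) (1, 0) := by
    intro x ω
    have := hd x ω
    rw [← add_zero x] at this
    simpa [AddCircle.coe_add] using (this.comp_const_add x 0).deriv
  refine ⟨fun θ ω => deriv (fun y : ℝ => F (θ + (y : Torus)) ω) 0, ?_, fun x ω => ?_⟩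
  · refine continuous_of_continuous_lift (f := fun θ ω =>
      deriv (fun y : ℝ => F (θ + (y : Torus)) ω) 0) ?_
    simp only [heq]
    exact (hF.continuous_fderiv one_ne_zero).clm_apply continuous_const
  · simp only [heq]
    exact hd x ω

/-- One explicit Euler step of the angle. -/
def eulerStep (δ a b : ℝ) (θ : Torus) (ω : ℝ) : Torus :=
  θ + ((δ * ω - a * torusSin θ + b * torusCos θ : ℝ) : Torus)

lemma eulerStep_coe (δ a b x ω : ℝ) : eulerStep δ a b (x : Torus) ω =
    ((x + (δ * ω - a * Real.sin x + b * Real.cos x) : ℝ) : Torus) := by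
  rw [eulerStep, torusSin_coe, torusCos_coe, ← AddCircle.coe_add]

lemma abs_sin_sub_sin_le (x y : ℝ) : |Real.sin x - Real.sin y| ≤ |x - y| := by
  have := Real.lipschitzWith_sin.dist_le_mul x y
  simpa [Real.dist_eq] using this

lemma abs_cos_sub_cos_le (x y : ℝ) : |Real.cos x - Real.cos y| ≤ |x - y| := by
  have := Real.lipschitzWith_cos.dist_le_mul x y
  simpa [Real.dist_eq] using this

lemma abs_mul_add_mul_le {a b u v w β : ℝ} (hab : |a| + |b| ≤ β) (hu : |u| ≤ w) (hv : |v| ≤ w) :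
    |a * u + b * v| ≤ β * w := by
  have hw : 0 ≤ w := (abs_nonneg _).trans hu
  refine (abs_add_le _ _).trans ?_
  rw [abs_mul, abs_mul]
  nlinarith [mul_le_mul_of_nonneg_left hu (abs_nonneg a), mul_le_mul_of_nonneg_left hv (abs_nonneg b),
    mul_le_mul_of_nonneg_right hab hw]

lemma IsObservable.abs_sub_le_lift {k k' : Torus → ℝ → ℝ} {A L : ℝ} (h : IsObservable k k' A L)
    (x y ω : ℝ) : |k (x : Torus) ω - k (y : Torus) ω| ≤ A * |x - y| :=
  Convex.norm_image_sub_le_of_norm_hasDerivWithin_le (s := univ)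
    (fun z _ => (h.hasDerivAt z ω).hasDerivWithinAt) (fun z _ => h.deriv_bound z ω) convex_univ
    (mem_univ y) (mem_univ x)

lemma IsObservable.taylor {k k' : Torus → ℝ → ℝ} {A L : ℝ} (h : IsObservable k k' A L)
    (hA : 0 ≤ A) (x v ω : ℝ) :
    |k ((x + v : ℝ) : Torus) ω - k (x : Torus) ω - k' (x : Torus) ω * v| ≤ A * v ^ 2 := by
  have hd : ∀ z ∈ uIcc x (x + v), HasDerivWithinAt
      (fun y : ℝ => k (y : Torus) ω - k' (x : Torus) ω * y)
      (k' (z : Torus) ω - k' (x : Torus) ω) (uIcc x (x + v)) z := fun z _ => by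
    have := (h.hasDerivAt z ω).sub ((hasDerivAt_id z).const_mul (k' (x : Torus) ω))
    rw [mul_one] at this
    exact this.hasDerivWithinAt
  have hb : ∀ z ∈ uIcc x (x + v), ‖k' (z : Torus) ω - k' (x : Torus) ω‖ ≤ A * |v| := fun z hz => by
    refine (h.deriv_lipschitz z x ω).trans (mul_le_mul_of_nonneg_left ?_ hA)
    simpa using abs_sub_left_of_mem_uIcc hz
  have := Convex.norm_image_sub_le_of_norm_hasDerivWithin_le hd hb (convex_uIcc x (x + v))
    left_mem_uIcc right_mem_uIcc
  rw [Real.norm_eq_abs, Real.norm_eq_abs, add_sub_cancel_left, mul_assoc, abs_mul_abs_self] at this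
  rw [sq]
  convert this using 2
  ring

lemma IsObservable.comp_eulerStep {k k' : Torus → ℝ → ℝ} {A L : ℝ} (h : IsObservable k k' A L)
    (hA : 0 ≤ A) {δ a b β : ℝ} (hδ : 0 ≤ δ) (hab : |a| + |b| ≤ β) (hβ : β ≤ 1) :
    IsObservable (fun θ ω => k (eulerStep δ a b θ ω) ω)
      (fun θ ω => k' (eulerStep δ a b θ ω) ω * (1 - (a * torusCos θ + b * torusSin θ)))
      (A * (1 + 4 * β)) (L + δ * A) := by
  have hβ0 : 0 ≤ β := (add_nonneg (abs_nonneg a) (abs_nonneg b)).trans hab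
  have hmap : ContDiff ℝ 1 fun q : ℝ × ℝ =>
      (q.1 + (δ * q.2 - a * Real.sin q.1 + b * Real.cos q.1), q.2) := by fun_prop
  have hq : ∀ x : ℝ, |1 - (a * Real.cos x + b * Real.sin x)| ≤ 1 + β := fun x => by
    refine (abs_sub _ _).trans ?_
    have := abs_mul_add_mul_le hab (Real.abs_cos_le_one x) (Real.abs_sin_le_one x)
    rw [abs_one]; linarith
  refine ⟨?_, ?_, ?_, fun θ ω => h.abs_le_one _ _, ?_, ?_, ?_⟩
  · simp only [eulerStep_coe]
    exact h.contDiff.comp hmap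
  · simp only [eulerStep_coe, torusCos_coe, torusSin_coe]
    exact (h.contDiff_deriv.comp hmap).mul (by fun_prop)
  · intro x ω
    simp only [eulerStep_coe, torusCos_coe, torusSin_coe]
    have h1 : HasDerivAt (fun y : ℝ => y + (δ * ω - a * Real.sin y + b * Real.cos y))
        (1 - (a * Real.cos x + b * Real.sin x)) x := by
      have := (hasDerivAt_id x).add ((((hasDerivAt_const x (δ * ω)).sub
        ((Real.hasDerivAt_sin x).const_mul a))).add ((Real.hasDerivAt_cos x).const_mul b))
      convert! this using 1
      ring
    exact (h.hasDerivAt _ ω).comp x h1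
  · intro θ ω
    obtain ⟨x, rfl⟩ := exists_coe_eq θ
    rw [torusCos_coe, torusSin_coe, abs_mul]
    refine (mul_le_mul (h.deriv_bound _ _) (hq x) (abs_nonneg _) hA).trans ?_
    exact mul_le_mul_of_nonneg_left (by linarith) hA
  · intro x y ω
    simp only [eulerStep_coe, torusCos_coe, torusSin_coe]
    set X := x + (δ * ω - a * Real.sin x + b * Real.cos x) with hX
    set Y := y + (δ * ω - a * Real.sin y + b * Real.cos y) with hY
    have hs := abs_sin_sub_sin_le x y
    have hc := abs_cos_sub_cos_le x y
    have hXY : |X - Y| ≤ (1 + β) * |x - y| := by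
      have e : X - Y = (x - y) + ((-a) * (Real.sin x - Real.sin y) +
        b * (Real.cos x - Real.cos y)) := by rw [hX, hY]; ring
      rw [e]
      have := abs_mul_add_mul_le (a := -a) (b := b) (β := β) (by rwa [abs_neg]) hs hc
      exact (abs_add_le _ _).trans (by linarith)
    have hqq : |a * (Real.cos x - Real.cos y) + b * (Real.sin x - Real.sin y)| ≤ β * |x - y| :=
      abs_mul_add_mul_le hab hc hs
    have e : k' (X : Torus) ω * (1 - (a * Real.cos x + b * Real.sin x)) -
        k' (Y : Torus) ω * (1 - (a * Real.cos y + b * Real.sin y)) =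
        (k' (X : Torus) ω - k' (Y : Torus) ω) * (1 - (a * Real.cos x + b * Real.sin x)) -
        k' (Y : Torus) ω * (a * (Real.cos x - Real.cos y) + b * (Real.sin x - Real.sin y)) := by
      ring
    rw [e]
    refine (abs_sub _ _).trans ?_
    rw [abs_mul, abs_mul]
    have t1 : |k' (X : Torus) ω - k' (Y : Torus) ω| ≤ A * ((1 + β) * |x - y|) :=
      (h.deriv_lipschitz X Y ω).trans (mul_le_mul_of_nonneg_left hXY hA)
    have t2 := mul_le_mul t1 (hq x) (abs_nonneg _) (by positivity)
    have t3 := mul_le_mul (h.deriv_bound (Y : Torus) ω) hqq (abs_nonneg _) hA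
    refine (add_le_add t2 t3).trans ?_
    have : β * β ≤ β := mul_le_of_le_one_left hβ0 hβ
    have h5 : 0 ≤ A * |x - y| := by positivity
    nlinarith
  · intro θ ω ω'
    obtain ⟨x, rfl⟩ := exists_coe_eq θ
    simp only [eulerStep_coe]
    have t1 := h.abs_sub_le_lift (x + (δ * ω - a * Real.sin x + b * Real.cos x))
      (x + (δ * ω' - a * Real.sin x + b * Real.cos x)) ω
    have t2 := h.freq_lipschitz ((x + (δ * ω' - a * Real.sin x + b * Real.cos x) : ℝ) : Torus) ω ω'
    have e : x + (δ * ω - a * Real.sin x + b * Real.cos x) -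
      (x + (δ * ω' - a * Real.sin x + b * Real.cos x)) = δ * (ω - ω') := by ring
    rw [e, abs_mul, abs_of_nonneg hδ] at t1
    refine (abs_sub_le _ (k ((x + (δ * ω' - a * Real.sin x + b * Real.cos x) : ℝ) : Torus) ω)
      _).trans ?_
    linarith

lemma isObservable_cos : IsObservable (fun θ _ => torusCos θ) (fun θ _ => -torusSin θ) 1 0 := by
  refine ⟨?_, ?_, fun x ω => ?_, fun θ _ => abs_torusCos_le θ, fun θ _ => ?_, fun x y _ => ?_,
    fun _ _ _ => by simp⟩
  · simp only [torusCos_coe]; fun_prop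
  · simp only [torusSin_coe]; fun_prop
  · simp only [torusCos_coe, torusSin_coe]; exact Real.hasDerivAt_cos x
  · rw [abs_neg]; exact abs_torusSin_le θ
  · rw [torusSin_coe, torusSin_coe, one_mul, ← abs_neg]
    convert abs_sin_sub_sin_le x y using 2; ring

lemma isObservable_sin : IsObservable (fun θ _ => torusSin θ) (fun θ _ => torusCos θ) 1 0 := by
  refine ⟨?_, ?_, fun x ω => ?_, fun θ _ => abs_torusSin_le θ, fun θ _ => abs_torusCos_le θ,
    fun x y _ => ?_, fun _ _ _ => by simp⟩
  · simp only [torusSin_coe]; fun_prop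
  · simp only [torusCos_coe]; fun_prop
  · simp only [torusCos_coe, torusSin_coe]; exact Real.hasDerivAt_sin x
  · rw [torusCos_coe, torusCos_coe, one_mul]
    exact abs_cos_sub_cos_le x y

/-- A `C¹` function of the frequency, bounded by `Q` and supported in `[-R, R]`. -/
structure IsFreqTest (φ : ℝ → ℝ) (R Q : ℝ) : Prop where
  contDiff : ContDiff ℝ 1 φ
  eq_zero : ∀ ω, R < |ω| → φ ω = 0
  bound : ∀ ω, |φ ω| ≤ Q

lemma IsFreqTest.nonneg {φ : ℝ → ℝ} {R Q : ℝ} (h : IsFreqTest φ R Q) : 0 ≤ Q :=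
  (abs_nonneg _).trans (h.bound 0)

lemma IsObservable.nonneg {k k' : Torus → ℝ → ℝ} {A L : ℝ} (h : IsObservable k k' A L) : 0 ≤ A :=
  (abs_nonneg _).trans (h.deriv_bound 0 0)

lemma IsObservable.continuous {k k' : Torus → ℝ → ℝ} {A L : ℝ} (h : IsObservable k k' A L) :
    Continuous fun p : Phase => k p.1 p.2 :=
  continuous_of_continuous_lift h.contDiff.continuous

lemma IsObservable.continuous_deriv {k k' : Torus → ℝ → ℝ} {A L : ℝ}
    (h : IsObservable k k' A L) : Continuous fun p : Phase => k' p.1 p.2 :=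
  continuous_of_continuous_lift h.contDiff_deriv.continuous

section Localize

variable {k k' : Torus → ℝ → ℝ} {A L : ℝ} {φ : ℝ → ℝ} {R Q : ℝ}

lemma IsObservable.isLocalObservable (h : IsObservable k k' A L) (hφ : IsFreqTest φ R Q) :
    IsLocalObservable (fun θ ω => φ ω * k θ ω) (fun θ ω => φ ω * k' θ ω) R (Q * A) where
  contDiff := (hφ.contDiff.comp contDiff_snd).mul h.contDiff
  continuous_deriv := (hφ.contDiff.continuous.comp continuous_snd).mul h.continuous_deriv
  hasDerivAt x ω := (h.hasDerivAt x ω).const_mul (φ ω)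
  eq_zero θ ω hω := by rw [hφ.eq_zero ω hω, zero_mul]
  deriv_bound θ ω := by
    rw [abs_mul]
    exact mul_le_mul (hφ.bound ω) (h.deriv_bound θ ω) (abs_nonneg _) hφ.nonneg

lemma IsObservable.exists_second_deriv (h : IsObservable k k' A L) :
    ∃ k'' : Torus → ℝ → ℝ, (Continuous fun p : Phase => k'' p.1 p.2) ∧
      (∀ x ω : ℝ, HasDerivAt (fun y : ℝ => k' (y : Torus) ω) (k'' (x : Torus) ω) x) ∧
      ∀ θ ω, |k'' θ ω| ≤ A := by
  obtain ⟨k'', hc, hd⟩ := exists_angular_deriv h.contDiff_deriv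
  refine ⟨k'', hc, hd, fun θ ω => ?_⟩
  obtain ⟨x, rfl⟩ := exists_coe_eq θ
  exact (hd x ω).le_of_lip' h.nonneg (Eventually.of_forall fun y => h.deriv_lipschitz y x ω)

lemma IsObservable.exists_isLocalObservable_freq_mul (h : IsObservable k k' A L)
    (hφ : IsFreqTest φ R Q) :
    ∃ f', IsLocalObservable (fun θ ω => ω * (φ ω * k' θ ω)) f' R (|R| * (Q * A)) := by
  obtain ⟨k'', hc, hd, hb⟩ := h.exists_second_deriv
  refine ⟨fun θ ω => ω * (φ ω * k'' θ ω), ?_, ?_, fun x ω => ?_, fun θ ω hω => ?_,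
    fun θ ω => ?_⟩
  · exact contDiff_snd.mul ((hφ.contDiff.comp contDiff_snd).mul h.contDiff_deriv)
  · exact continuous_snd.mul ((hφ.contDiff.continuous.comp continuous_snd).mul hc)
  · exact ((hd x ω).const_mul _).const_mul _
  · rw [hφ.eq_zero ω hω]; simp
  · by_cases hω : R < |ω|
    · rw [hφ.eq_zero ω hω]
      have := hφ.nonneg; have := h.nonneg
      simp; positivity
    · rw [abs_mul, abs_mul]
      exact mul_le_mul ((not_lt.1 hω).trans (le_abs_self R))
        (mul_le_mul (hφ.bound ω) (hb θ ω) (abs_nonneg _) hφ.nonneg) (by positivity)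
        (abs_nonneg _)

lemma IsObservable.exists_isLocalObservable_mul (h : IsObservable k k' A L)
    (hφ : IsFreqTest φ R Q) {τ τ' : Torus → ℝ}
    (hτ : ContDiff ℝ 1 fun x : ℝ => τ (x : Torus)) (hτ' : Continuous τ')
    (hd : ∀ x : ℝ, HasDerivAt (fun y : ℝ => τ (y : Torus)) (τ' (x : Torus)) x)
    (hb : ∀ θ, |τ θ| ≤ 1) (hb' : ∀ θ, |τ' θ| ≤ 1) :
    ∃ f', IsLocalObservable (fun θ ω => τ θ * (φ ω * k' θ ω)) f' R (2 * (Q * A)) := by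
  obtain ⟨k'', hc, hd2, hb2⟩ := h.exists_second_deriv
  have hQ := hφ.nonneg
  have hA := h.nonneg
  refine ⟨fun θ ω => τ' θ * (φ ω * k' θ ω) + τ θ * (φ ω * k'' θ ω), ⟨?_, ?_, fun x ω => ?_,
    fun θ ω hω => ?_, fun θ ω => ?_⟩⟩
  · exact (hτ.comp contDiff_fst).mul ((hφ.contDiff.comp contDiff_snd).mul h.contDiff_deriv)
  · have hτc : Continuous τ :=
      (QuotientAddGroup.isOpenQuotientMap_mk.continuous_comp_iff).1 hτ.continuous
    have hφc := hφ.contDiff.continuous.comp (continuous_snd (X := Torus) (Y := ℝ))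
    exact ((hτ'.comp continuous_fst).mul (hφc.mul h.continuous_deriv)).add
      ((hτc.comp continuous_fst).mul (hφc.mul hc))
  · exact (hd x).mul ((hd2 x ω).const_mul _)
  · rw [hφ.eq_zero ω hω]; simp
  · have key : ∀ u v : ℝ, |u| ≤ 1 → |v| ≤ A → |u * (φ ω * v)| ≤ Q * A := fun u v hu hv => by
      rw [abs_mul, abs_mul]
      exact (mul_le_of_le_one_left (by positivity) hu).trans
        (mul_le_mul (hφ.bound ω) hv (abs_nonneg _) hQ)
    refine (abs_add_le _ _).trans ?_
    linarith [key _ _ (hb' θ) (h.deriv_bound θ ω), key _ _ (hb θ) (hb2 θ ω)]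

end Localize

lemma abs_intervalIntegral_le {F : ℝ → ℝ} {s t C : ℝ} (hst : s ≤ t)
    (hC : ∀ r ∈ Icc s t, |F r| ≤ C) : |∫ r in s..t, F r| ≤ C * (t - s) := by
  have := intervalIntegral.norm_integral_le_of_norm_le_const (a := s) (b := t) (f := F) (C := C)
    fun r hr => hC r (by rw [uIoc_of_le hst] at hr; exact ⟨hr.1.le, hr.2⟩)
  rwa [abs_of_nonneg (sub_nonneg.2 hst)] at this

section EulerError

variable {K T B M : ℝ} {μ : ℝ → Measure Phase} {C S : ℝ → ℝ} {k k' : Torus → ℝ → ℝ} {A L : ℝ}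
  {φ : ℝ → ℝ} {R Q : ℝ}

lemma IsTransported.abs_integral_sub_linear_le (h : IsTransported K T B M μ C S) (hK : 0 ≤ K)
    (hk : IsObservable k k' A L) (hφ : IsFreqTest φ R Q) {s t : ℝ} (hs : s ∈ Icc 0 T)
    (ht : t ∈ Icc 0 T) (hst : s ≤ t) :
    |(∫ p, φ p.2 * k p.1 p.2 ∂(μ t)) - (∫ p, φ p.2 * k p.1 p.2 ∂(μ s)) -
        ((t - s) * (∫ p, p.2 * (φ p.2 * k' p.1 p.2) ∂(μ s)) -
          ((K * ∫ r in s..t, C r) * (∫ p, torusSin p.1 * (φ p.2 * k' p.1 p.2) ∂(μ s)) -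
            (K * ∫ r in s..t, S r) * ∫ p, torusCos p.1 * (φ p.2 * k' p.1 p.2) ∂(μ s)))| ≤
      2 * (|R| + 2 * K * B) ^ 2 * (Q * A) * M * (t - s) ^ 2 := by
  set V := |R| + 2 * K * B with hV
  have hA := hk.nonneg
  have hQ := hφ.nonneg
  have hB : 0 ≤ B := (abs_nonneg _).trans (h.abs_cos_le s hs)
  have hM : 0 ≤ M := measureReal_nonneg.trans (h.mass_le s hs)
  have hloc := hk.isLocalObservable hφ
  obtain ⟨f1, hf1⟩ := hk.exists_isLocalObservable_freq_mul hφ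
  obtain ⟨f2, hf2⟩ := hk.exists_isLocalObservable_mul hφ (τ := torusSin) (τ' := torusCos)
    (by simp only [torusSin_coe]; fun_prop) continuous_torusCos
    (fun x => isObservable_sin.hasDerivAt x 0) abs_torusSin_le abs_torusCos_le
  obtain ⟨f3, hf3⟩ := hk.exists_isLocalObservable_mul hφ (τ := torusCos)
    (τ' := fun θ => -torusSin θ) (by simp only [torusCos_coe]; fun_prop)
    continuous_torusSin.neg (fun x => isObservable_cos.hasDerivAt x 0) abs_torusCos_le
    (fun θ => by rw [abs_neg]; exact abs_torusSin_le θ)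
  set P := fun r => ∫ p, p.2 * (φ p.2 * k' p.1 p.2) ∂(μ r) with hP
  set Q1 := fun r => ∫ p, torusSin p.1 * (φ p.2 * k' p.1 p.2) ∂(μ r) with hQ1
  set Q2 := fun r => ∫ p, torusCos p.1 * (φ p.2 * k' p.1 p.2) ∂(μ r) with hQ2
  have hCi := intervalIntegrable_of_mem (integrableOn_Icc_of_bound h.measurable_cos h.abs_cos_le)
    hs ht
  have hSi := intervalIntegrable_of_mem (integrableOn_Icc_of_bound h.measurable_sin h.abs_sin_le)
    hs ht
  have hlin : (t - s) * P s - ((K * ∫ r in s..t, C r) * Q1 s - (K * ∫ r in s..t, S r) * Q2 s) =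
      ∫ r in s..t, (P s - K * (C r * Q1 s - S r * Q2 s)) := by
    rw [intervalIntegral.integral_sub intervalIntegrable_const
      (((hCi.mul_const _).sub (hSi.mul_const _)).const_mul _),
      intervalIntegral.integral_const_mul,
      intervalIntegral.integral_sub (hCi.mul_const _) (hSi.mul_const _),
      intervalIntegral.integral_mul_const, intervalIntegral.integral_mul_const,
      intervalIntegral.integral_const, smul_eq_mul]
    ring
  rw [h.weak _ _ _ _ hloc s hs t ht]
  change |(∫ r in s..t, transportRate K μ C S (fun θ ω => φ ω * k' θ ω) r) -
    ((t - s) * P s - ((K * ∫ r in s..t, C r) * Q1 s - (K * ∫ r in s..t, S r) * Q2 s))| ≤ _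
  rw [hlin, ← intervalIntegral.integral_sub
    (intervalIntegrable_of_mem (h.integrableOn_rate hloc) hs ht)
    (intervalIntegrable_const.sub (((hCi.mul_const _).sub (hSi.mul_const _)).const_mul _))]
  refine (abs_intervalIntegral_le hst (C := 2 * V ^ 2 * (Q * A) * M * (t - s))
    fun r hr => ?_).trans (le_of_eq (by ring))
  have hr' : r ∈ Icc 0 T := ⟨hs.1.trans hr.1, hr.2.trans ht.2⟩
  have hrs : |r - s| ≤ t - s := by rw [abs_of_nonneg (sub_nonneg.2 hr.1)]; linarith [hr.2]
  have hV0 : 0 ≤ V := by positivity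
  have b1 : |P r - P s| ≤ V * (|R| * (Q * A)) * M * (t - s) :=
    (h.abs_integral_sub_le hK hf1 hs hr').trans (mul_le_mul_of_nonneg_left hrs (by positivity))
  have b2 : |Q1 r - Q1 s| ≤ V * (2 * (Q * A)) * M * (t - s) :=
    (h.abs_integral_sub_le hK hf2 hs hr').trans (mul_le_mul_of_nonneg_left hrs (by positivity))
  have b3 : |Q2 r - Q2 s| ≤ V * (2 * (Q * A)) * M * (t - s) :=
    (h.abs_integral_sub_le hK hf3 hs hr').trans (mul_le_mul_of_nonneg_left hrs (by positivity))
  have e : transportRate K μ C S (fun θ ω => φ ω * k' θ ω) r -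
      (P s - K * (C r * Q1 s - S r * Q2 s)) =
      (P r - P s) - K * (C r * (Q1 r - Q1 s) - S r * (Q2 r - Q2 s)) := by
    change P r - K * (C r * Q1 r - S r * Q2 r) - _ = _
    ring
  rw [e]
  have c2 : |C r * (Q1 r - Q1 s)| ≤ B * (V * (2 * (Q * A)) * M * (t - s)) := by
    rw [abs_mul]; exact mul_le_mul (h.abs_cos_le r hr') b2 (abs_nonneg _) hB
  have c3 : |S r * (Q2 r - Q2 s)| ≤ B * (V * (2 * (Q * A)) * M * (t - s)) := by
    rw [abs_mul]; exact mul_le_mul (h.abs_sin_le r hr') b3 (abs_nonneg _) hB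
  have c4 := mul_le_mul_of_nonneg_left ((abs_sub _ _).trans (add_le_add c2 c3)) hK
  refine (abs_sub _ _).trans ?_
  rw [abs_mul, abs_of_nonneg hK]
  refine (add_le_add b1 c4).trans ?_
  have e2 : 2 * V ^ 2 * (Q * A) * M * (t - s) -
      (V * (|R| * (Q * A)) * M * (t - s) +
        K * (B * (V * (2 * (Q * A)) * M * (t - s)) + B * (V * (2 * (Q * A)) * M * (t - s)))) =
      V * |R| * (Q * A) * M * (t - s) := by rw [hV]; ring
  have : 0 ≤ V * |R| * (Q * A) * M * (t - s) := by
    have := sub_nonneg.2 hst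
    positivity
  linarith

lemma IsObservable.abs_integral_eulerStep_sub_linear_le (hk : IsObservable k k' A L)
    (hφ : IsFreqTest φ R Q) (ν : Measure Phase) [IsFiniteMeasure ν] {δ a b v : ℝ} (hδ : 0 ≤ δ)
    (hv : δ * |R| + (|a| + |b|) ≤ v) :
    |(∫ p, φ p.2 * k (eulerStep δ a b p.1 p.2) p.2 ∂ν) - (∫ p, φ p.2 * k p.1 p.2 ∂ν) -
        (δ * (∫ p, p.2 * (φ p.2 * k' p.1 p.2) ∂ν) -
          (a * (∫ p, torusSin p.1 * (φ p.2 * k' p.1 p.2) ∂ν) -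
            b * ∫ p, torusCos p.1 * (φ p.2 * k' p.1 p.2) ∂ν))| ≤
      Q * A * v ^ 2 * ν.real univ := by
  have hA := hk.nonneg
  have hQ := hφ.nonneg
  have hloc := hk.isLocalObservable hφ
  have hφc := hφ.contDiff.continuous.comp (continuous_snd (X := Torus) (Y := ℝ))
  have hec : Continuous fun p : Phase => (eulerStep δ a b p.1 p.2, p.2) := by
    refine Continuous.prodMk ?_ continuous_snd
    refine continuous_fst.add ((AddCircle.continuous_mk' (2 * π)).comp ?_)
    have := continuous_torusSin.comp (continuous_fst (X := Torus) (Y := ℝ))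
    have := continuous_torusCos.comp (continuous_fst (X := Torus) (Y := ℝ))
    fun_prop
  have hφk : ∀ θ ω, |φ ω * k θ ω| ≤ Q * 1 := fun θ ω => by
    rw [abs_mul]; exact mul_le_mul (hφ.bound ω) (hk.abs_le_one _ _) (abs_nonneg _) hQ
  have i0 : Integrable (fun p : Phase => φ p.2 * k (eulerStep δ a b p.1 p.2) p.2) ν :=
    integrable_of_continuous_bounded (hφc.mul (hk.continuous.comp hec)) (fun p => hφk _ _)
  have i1 : Integrable (fun p : Phase => φ p.2 * k p.1 p.2) ν :=
    integrable_of_continuous_bounded (hφc.mul hk.continuous) (fun p => hφk _ _)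
  have i2 : Integrable (fun p : Phase => p.2 * (φ p.2 * k' p.1 p.2)) ν :=
    integrable_of_continuous_bounded (continuous_snd.mul hloc.continuous_deriv)
      hloc.abs_freq_mul_le
  have i3 : Integrable (fun p : Phase => torusSin p.1 * (φ p.2 * k' p.1 p.2)) ν :=
    integrable_of_continuous_bounded
      ((continuous_torusSin.comp continuous_fst).mul hloc.continuous_deriv)
      (hloc.abs_mul_le abs_torusSin_le)
  have i4 : Integrable (fun p : Phase => torusCos p.1 * (φ p.2 * k' p.1 p.2)) ν :=
    integrable_of_continuous_bounded
      ((continuous_torusCos.comp continuous_fst).mul hloc.continuous_deriv)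
      (hloc.abs_mul_le abs_torusCos_le)
  have i5 : Integrable (fun p : Phase => a * (torusSin p.1 * (φ p.2 * k' p.1 p.2)) -
      b * (torusCos p.1 * (φ p.2 * k' p.1 p.2))) ν := (i3.const_mul a).sub (i4.const_mul b)
  have i6 : Integrable (fun p : Phase => δ * (p.2 * (φ p.2 * k' p.1 p.2)) -
      (a * (torusSin p.1 * (φ p.2 * k' p.1 p.2)) -
      b * (torusCos p.1 * (φ p.2 * k' p.1 p.2)))) ν := (i2.const_mul δ).sub i5
  have i7 : Integrable (fun p : Phase => φ p.2 * k (eulerStep δ a b p.1 p.2) p.2 -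
      φ p.2 * k p.1 p.2) ν := i0.sub i1
  rw [← integral_const_mul, ← integral_const_mul, ← integral_const_mul,
    ← integral_sub (i3.const_mul a) (i4.const_mul b), ← integral_sub (i2.const_mul δ) i5,
    ← integral_sub i0 i1, ← integral_sub i7 i6]
  refine abs_integral_le_of_bound fun p => ?_
  obtain ⟨θ, ω⟩ := p
  obtain ⟨x, rfl⟩ := exists_coe_eq θ
  simp only [eulerStep_coe, torusSin_coe, torusCos_coe]
  by_cases hω : R < |ω|
  · rw [hφ.eq_zero ω hω]; simp; positivity
  set w := δ * ω - a * Real.sin x + b * Real.cos x with hw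
  have hwv : |w| ≤ v := by
    refine le_trans ?_ hv
    have e : w = δ * ω + ((-a) * Real.sin x + b * Real.cos x) := by rw [hw]; ring
    rw [e]
    refine (abs_add_le _ _).trans (add_le_add ?_ ?_)
    · rw [abs_mul, abs_of_nonneg hδ]
      exact mul_le_mul_of_nonneg_left ((not_lt.1 hω).trans (le_abs_self R)) hδ
    · have := abs_mul_add_mul_le (a := -a) (b := b) (β := |a| + |b|) (by rw [abs_neg])
        (Real.abs_sin_le_one x) (Real.abs_cos_le_one x)
      rwa [mul_one] at this
  have e : φ ω * k ((x + w : ℝ) : Torus) ω - φ ω * k (x : Torus) ω -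
      (δ * (ω * (φ ω * k' (x : Torus) ω)) - (a * (Real.sin x * (φ ω * k' (x : Torus) ω)) -
        b * (Real.cos x * (φ ω * k' (x : Torus) ω)))) =
      φ ω * (k ((x + w : ℝ) : Torus) ω - k (x : Torus) ω - k' (x : Torus) ω * w) := by
    rw [hw]; ring
  rw [e, abs_mul, mul_assoc]
  refine mul_le_mul (hφ.bound ω) ((hk.taylor hA x w ω).trans ?_) (abs_nonneg _) hQ
  exact mul_le_mul_of_nonneg_left (sq_le_sq' (by linarith [neg_abs_le w]) ((le_abs_self w).trans hwv)) hA

end EulerError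

lemma IsObservable.mono {k k' : Torus → ℝ → ℝ} {A L A' L' : ℝ} (h : IsObservable k k' A L)
    (hA : A ≤ A') (hL : L ≤ L') : IsObservable k k' A' L' where
  contDiff := h.contDiff
  contDiff_deriv := h.contDiff_deriv
  hasDerivAt := h.hasDerivAt
  abs_le_one := h.abs_le_one
  deriv_bound θ ω := (h.deriv_bound θ ω).trans hA
  deriv_lipschitz x y ω :=
    (h.deriv_lipschitz x y ω).trans (mul_le_mul_of_nonneg_right hA (abs_nonneg _))
  freq_lipschitz θ ω ω' :=
    (h.freq_lipschitz θ ω ω').trans (mul_le_mul_of_nonneg_right hL (abs_nonneg _))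

section Euler

variable {K T B M : ℝ} {μ : ℝ → Measure Phase} {C S C' S' : ℝ → ℝ} {k k' : Torus → ℝ → ℝ}
  {A L : ℝ} {φ : ℝ → ℝ} {R Q : ℝ}

lemma IsTransported.abs_integral_sub_eulerStep_le (h : IsTransported K T B M μ C' S')
    (hK : 0 ≤ K) (hk : IsObservable k k' A L) (hφ : IsFreqTest φ R Q) {s t a b : ℝ}
    (hs : s ∈ Icc 0 T) (ht : t ∈ Icc 0 T) (hst : s ≤ t) (hab : |a| + |b| ≤ 2 * K * B * (t - s)) :
    |(∫ p, φ p.2 * k p.1 p.2 ∂(μ t)) -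
        ∫ p, φ p.2 * k (eulerStep (t - s) a b p.1 p.2) p.2 ∂(μ s)| ≤
      Q * A * M * (3 * (|R| + 2 * K * B) ^ 2 * (t - s) ^ 2 +
        (|a - K * ∫ r in s..t, C' r| + |b - K * ∫ r in s..t, S' r|)) := by
  have hfin := h.finite s hs
  have hA := hk.nonneg
  have hQ := hφ.nonneg
  have hM := h.mass_le s hs
  have hB : 0 ≤ B := (abs_nonneg _).trans (h.abs_cos_le s hs)
  have hδ := sub_nonneg.2 hst
  have hloc := hk.isLocalObservable hφ
  have h1 := h.abs_integral_sub_linear_le hK hk hφ hs ht hst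
  have h2 := hk.abs_integral_eulerStep_sub_linear_le hφ (μ s) (a := a) (b := b)
    (v := (|R| + 2 * K * B) * (t - s)) hδ (by linarith)
  have h3 : Q * A * ((|R| + 2 * K * B) * (t - s)) ^ 2 * (μ s).real univ ≤
      Q * A * ((|R| + 2 * K * B) * (t - s)) ^ 2 * M :=
    mul_le_mul_of_nonneg_left hM (by positivity)
  have hQ1 : |∫ p, torusSin p.1 * (φ p.2 * k' p.1 p.2) ∂(μ s)| ≤ Q * A * M :=
    (abs_integral_le_of_bound (hloc.abs_mul_le abs_torusSin_le)).trans
      (mul_le_mul_of_nonneg_left hM (by positivity))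
  have hQ2 : |∫ p, torusCos p.1 * (φ p.2 * k' p.1 p.2) ∂(μ s)| ≤ Q * A * M :=
    (abs_integral_le_of_bound (hloc.abs_mul_le abs_torusCos_le)).trans
      (mul_le_mul_of_nonneg_left hM (by positivity))
  set P := ∫ p, p.2 * (φ p.2 * k' p.1 p.2) ∂(μ s)
  set Q1 := ∫ p, torusSin p.1 * (φ p.2 * k' p.1 p.2) ∂(μ s)
  set Q2 := ∫ p, torusCos p.1 * (φ p.2 * k' p.1 p.2) ∂(μ s)
  set X := ∫ p, φ p.2 * k p.1 p.2 ∂(μ t)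
  set Y := ∫ p, φ p.2 * k p.1 p.2 ∂(μ s)
  set Z := ∫ p, φ p.2 * k (eulerStep (t - s) a b p.1 p.2) p.2 ∂(μ s)
  set c := K * ∫ r in s..t, C' r
  set d := K * ∫ r in s..t, S' r
  have e : X - Z = (X - Y - ((t - s) * P - (c * Q1 - d * Q2))) -
      (Z - Y - ((t - s) * P - (a * Q1 - b * Q2))) + ((a - c) * Q1 - (b - d) * Q2) := by ring
  have h4 : |(a - c) * Q1 - (b - d) * Q2| ≤ |a - c| * (Q * A * M) + |b - d| * (Q * A * M) := by
    refine (abs_sub _ _).trans ?_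
    rw [abs_mul, abs_mul]
    exact add_le_add (mul_le_mul_of_nonneg_left hQ1 (abs_nonneg _))
      (mul_le_mul_of_nonneg_left hQ2 (abs_nonneg _))
  rw [e]
  refine (abs_add_le _ _).trans ((add_le_add ((abs_sub _ _).trans (add_le_add h1 (h2.trans h3)))
    h4).trans (le_of_eq ?_))
  ring

lemma abs_mul_intervalIntegral_sub_le (hK : 0 ≤ K) {s t : ℝ} (hst : s ≤ t)
    (hC : IntervalIntegrable C volume s t) (hC' : IntervalIntegrable C' volume s t) :
    |(K * ∫ r in s..t, C r) - K * ∫ r in s..t, C' r| ≤ K * ∫ r in s..t, |C r - C' r| := by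
  rw [← mul_sub, ← intervalIntegral.integral_sub hC hC', abs_mul, abs_of_nonneg hK]
  exact mul_le_mul_of_nonneg_left (intervalIntegral.abs_integral_le_integral_abs hst) hK

lemma exists_observable_iterate (hK : 0 ≤ K) (hB : 0 ≤ B) (hC : IntegrableOn C (Icc 0 T))
    (hS : IntegrableOn S (Icc 0 T)) (hCB : ∀ t ∈ Icc 0 T, |C t| ≤ B)
    (hSB : ∀ t ∈ Icc 0 T, |S t| ≤ B) {δ : ℝ} (hδ : 0 ≤ δ) (hδ1 : 2 * K * B * δ ≤ 1) (n : ℕ)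
    (hn : n * δ ≤ T) (hk : IsObservable k k' A L) :
    ∃ k₀ k₀', IsObservable k₀ k₀' (A * (1 + 4 * (2 * K * B * δ)) ^ n)
        (L + n * δ * (A * (1 + 4 * (2 * K * B * δ)) ^ n)) ∧
      ∀ (M : ℝ) (μ : ℝ → Measure Phase) (C' S' : ℝ → ℝ), IsTransported K T B M μ C' S' →
      ∀ (φ : ℝ → ℝ) (R Q : ℝ), IsFreqTest φ R Q →
        |(∫ p, φ p.2 * k p.1 p.2 ∂(μ (n * δ))) - ∫ p, φ p.2 * k₀ p.1 p.2 ∂(μ 0)| ≤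
          Q * (A * (1 + 4 * (2 * K * B * δ)) ^ n) * M * (3 * (|R| + 2 * K * B) ^ 2 * (n * δ ^ 2) +
            K * ∫ r in (0 : ℝ)..n * δ, (|C r - C' r| + |S r - S' r|)) := by
  set β := 2 * K * B * δ with hβ
  have hβ0 : 0 ≤ β := by positivity
  induction n generalizing k k' A L with
  | zero => exact ⟨k, k', by simpa using hk, fun M μ C' S' h φ R Q hφ => by simp⟩
  | succ n ih =>
    have hA := hk.nonneg
    have hcast : ((n + 1 : ℕ) : ℝ) * δ = n * δ + δ := by push_cast; ring
    rw [hcast] at hn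
    have hnδ : 0 ≤ n * δ := by positivity
    have hs : n * δ ∈ Icc 0 T := ⟨hnδ, by linarith⟩
    have ht : n * δ + δ ∈ Icc 0 T := ⟨by linarith, hn⟩
    have h0 : (0 : ℝ) ∈ Icc 0 T := ⟨le_rfl, by linarith⟩
    have hsub : Icc (n * δ) (n * δ + δ) ⊆ Icc 0 T := Icc_subset_Icc hs.1 ht.2
    set a := K * ∫ r in (n * δ)..(n * δ + δ), C r with ha
    set b := K * ∫ r in (n * δ)..(n * δ + δ), S r with hb
    have hab : |a| + |b| ≤ β := by
      have h1 := abs_intervalIntegral_le (le_add_of_nonneg_right hδ)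
        fun r hr => hCB r (hsub hr)
      have h2 := abs_intervalIntegral_le (le_add_of_nonneg_right hδ)
        fun r hr => hSB r (hsub hr)
      rw [ha, hb, abs_mul, abs_mul, abs_of_nonneg hK]
      rw [add_sub_cancel_left] at h1 h2
      have := mul_le_mul_of_nonneg_left (add_le_add h1 h2) hK
      rw [hβ]; linarith
    obtain ⟨k₀, k₀', hk₀, hbound⟩ := ih hs.2 (hk.comp_eulerStep hA hδ hab hδ1)
    have hpow : A * (1 + 4 * β) * (1 + 4 * β) ^ n = A * (1 + 4 * β) ^ (n + 1) := by ring
    rw [hpow] at hk₀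
    have h1pow : 1 ≤ (1 + 4 * β) ^ (n + 1) := one_le_pow₀ (by linarith)
    have hAle : A ≤ A * (1 + 4 * β) ^ (n + 1) := le_mul_of_one_le_right hA h1pow
    refine ⟨k₀, k₀', hk₀.mono le_rfl ?_, ?_⟩
    · rw [hcast]
      have := mul_le_mul_of_nonneg_left hAle hδ
      linarith
    intro M μ C' S' h φ R Q hφ
    have hQ := hφ.nonneg
    have hM : 0 ≤ M := measureReal_nonneg.trans (h.mass_le 0 h0)
    have hC' := integrableOn_Icc_of_bound h.measurable_cos h.abs_cos_le
    have hS' := integrableOn_Icc_of_bound h.measurable_sin h.abs_sin_le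
    have hD : IntegrableOn (fun r => |C r - C' r| + |S r - S' r|) (Icc 0 T) :=
      (hC.sub hC').abs.add (hS.sub hS').abs
    have e1 := h.abs_integral_sub_eulerStep_le hK hk hφ hs ht (le_add_of_nonneg_right hδ)
      (a := a) (b := b) (by rw [add_sub_cancel_left]; exact hab)
    rw [add_sub_cancel_left] at e1
    have e2 := hbound M μ C' S' h φ R Q hφ
    have e3 := abs_mul_intervalIntegral_sub_le hK (le_add_of_nonneg_right hδ)
      (intervalIntegrable_of_mem hC hs ht) (intervalIntegrable_of_mem hC' hs ht)
    have e4 := abs_mul_intervalIntegral_sub_le hK (le_add_of_nonneg_right hδ)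
      (intervalIntegrable_of_mem hS hs ht) (intervalIntegrable_of_mem hS' hs ht)
    have e5 := intervalIntegral.integral_add_adjacent_intervals
      (intervalIntegrable_of_mem hD h0 hs) (intervalIntegrable_of_mem hD hs ht)
    have e6 := intervalIntegral.integral_add
      (intervalIntegrable_of_mem (hC.sub hC').abs hs ht)
      (intervalIntegrable_of_mem (hS.sub hS').abs hs ht)
    simp only [Pi.sub_apply] at e6
    rw [hpow] at e2
    rw [hcast, ← e5, e6]
    set G := A * (1 + 4 * β) ^ (n + 1)
    set I1 := ∫ r in (n * δ)..(n * δ + δ), |C r - C' r|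
    set I2 := ∫ r in (n * δ)..(n * δ + δ), |S r - S' r|
    have hI1 : 0 ≤ I1 := intervalIntegral.integral_nonneg (le_add_of_nonneg_right hδ)
      fun _ _ => abs_nonneg _
    have hI2 : 0 ≤ I2 := intervalIntegral.integral_nonneg (le_add_of_nonneg_right hδ)
      fun _ _ => abs_nonneg _
    have e7 : Q * A * M * (3 * (|R| + 2 * K * B) ^ 2 * δ ^ 2 +
        (|a - K * ∫ r in (n * δ)..(n * δ + δ), C' r| +
          |b - K * ∫ r in (n * δ)..(n * δ + δ), S' r|)) ≤
        Q * G * M * (3 * (|R| + 2 * K * B) ^ 2 * δ ^ 2 + (K * I1 + K * I2)) := by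
      refine mul_le_mul ?_ (by linarith) (by positivity) (by positivity)
      exact mul_le_mul_of_nonneg_right (mul_le_mul_of_nonneg_left hAle hQ) hM
    refine (abs_sub_le _ _ _).trans ((add_le_add (e1.trans e7) e2).trans (le_of_eq ?_))
    push_cast
    ring

lemma exists_observable_approx (hK : 0 ≤ K) (hB : 0 ≤ B) (hC : IntegrableOn C (Icc 0 T))
    (hS : IntegrableOn S (Icc 0 T)) (hCB : ∀ t ∈ Icc 0 T, |C t| ≤ B)
    (hSB : ∀ t ∈ Icc 0 T, |S t| ≤ B) {t : ℝ} (ht : t ∈ Icc 0 T) (hk : IsObservable k k' 1 0) :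
    ∀ᶠ N : ℕ in atTop, ∃ k₀ k₀', IsObservable k₀ k₀' (exp (8 * K * B * T))
        (T * exp (8 * K * B * T)) ∧
      ∀ (M : ℝ) (μ : ℝ → Measure Phase) (C' S' : ℝ → ℝ), IsTransported K T B M μ C' S' →
      ∀ (φ : ℝ → ℝ) (R Q : ℝ), IsFreqTest φ R Q →
        |(∫ p, φ p.2 * k p.1 p.2 ∂(μ t)) - ∫ p, φ p.2 * k₀ p.1 p.2 ∂(μ 0)| ≤
          Q * exp (8 * K * B * T) * M * (3 * (|R| + 2 * K * B) ^ 2 * (t ^ 2 / N) +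
            K * ∫ r in (0 : ℝ)..t, (|C r - C' r| + |S r - S' r|)) := by
  have hlim : Tendsto (fun N : ℕ => 2 * K * B * (t / N)) atTop (𝓝 0) := by
    simpa using (tendsto_const_div_atTop_nhds_zero_nat t).const_mul (2 * K * B)
  filter_upwards [hlim.eventually_le_const one_pos, eventually_gt_atTop 0] with N hN hN0
  have hNpos : (0 : ℝ) < N := by exact_mod_cast hN0
  have hNt : (N : ℝ) * (t / N) = t := by field_simp
  obtain ⟨k₀, k₀', hk₀, hb⟩ := exists_observable_iterate hK hB hC hS hCB hSB
    (div_nonneg ht.1 hNpos.le) hN N (by rw [hNt]; exact ht.2) hk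
  rw [hNt] at hk₀ hb
  have hpow : 1 * (1 + 4 * (2 * K * B * (t / N))) ^ N ≤ exp (8 * K * B * T) := by
    rw [one_mul]
    have h0 : 0 ≤ 4 * (2 * K * B * (t / N)) := by
      have := ht.1
      positivity
    have he := Real.add_one_le_exp (4 * (2 * K * B * (t / N)))
    calc (1 + 4 * (2 * K * B * (t / N))) ^ N
        ≤ exp (4 * (2 * K * B * (t / N))) ^ N :=
          pow_le_pow_left₀ (by linarith) (by linarith) N
      _ = exp (8 * K * B * t) := by
          rw [← Real.exp_nat_mul]; congr 1
          rw [show (N : ℝ) * (4 * (2 * K * B * (t / N))) = 8 * K * B * (N * (t / N)) by ring, hNt]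
      _ ≤ exp (8 * K * B * T) := Real.exp_le_exp.2
          (mul_le_mul_of_nonneg_left ht.2 (by positivity))
  refine ⟨k₀, k₀', hk₀.mono hpow ?_, fun M μ C' S' h φ R Q hφ => ?_⟩
  · rw [zero_add]
    exact mul_le_mul ht.2 hpow hk₀.nonneg (ht.1.trans ht.2)
  · have hM : 0 ≤ M := measureReal_nonneg.trans (h.mass_le t ht)
    have hQ := hφ.nonneg
    refine (hb M μ C' S' h φ R Q hφ).trans ?_
    rw [show (N : ℝ) * (t / N) ^ 2 = t ^ 2 / N by field_simp]
    refine mul_le_mul_of_nonneg_right (mul_le_mul_of_nonneg_right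
      (mul_le_mul_of_nonneg_left hpow hQ) hM) ?_
    have : 0 ≤ ∫ r in (0 : ℝ)..t, (|C r - C' r| + |S r - S' r|) :=
      intervalIntegral.integral_nonneg ht.1 fun _ _ => by positivity
    positivity

end Euler

/-- A sequence of bump functions on `ℝ` that shrink to the origin. -/
def shrinkingBump (n : ℕ) : ContDiffBump (0 : ℝ) :=
  ⟨1 / (n + 2), 1 / (n + 1), by positivity, by
    apply one_div_lt_one_div_of_lt <;> first | positivity | linarith⟩

/-- A sequence of smooth mollifiers on `ℝ`. -/
def mollifier (n : ℕ) (x : ℝ) : ℝ := (shrinkingBump n).normed volume x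

lemma tendsto_shrinkingBump_rOut : Tendsto (fun n => (shrinkingBump n).rOut) atTop (𝓝 0) :=
  tendsto_one_div_add_atTop_nhds_zero_nat

lemma mollifier_nonneg (n : ℕ) (x : ℝ) : 0 ≤ mollifier n x := (shrinkingBump n).nonneg_normed x

lemma integrable_mollifier (n : ℕ) : Integrable (mollifier n) := (shrinkingBump n).integrable_normed

lemma integral_mollifier (n : ℕ) : ∫ x, mollifier n x = 1 := (shrinkingBump n).integral_normed

lemma contDiff_mollifier (n : ℕ) : ContDiff ℝ 1 (mollifier n) :=
  (shrinkingBump n).contDiff_normed (n := 1)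

lemma mollifier_eq_zero (n : ℕ) {x : ℝ} (hx : 1 < |x|) : mollifier n x = 0 := by
  have : x ∉ Function.support ((shrinkingBump n).normed volume) := by
    rw [(shrinkingBump n).support_normed_eq, Metric.mem_ball, dist_zero_right, Real.norm_eq_abs,
      not_lt]
    refine le_trans ?_ hx.le
    change 1 / ((n : ℝ) + 1) ≤ 1
    exact (div_le_one (by positivity)).2 (by linarith [Nat.cast_nonneg (α := ℝ) n])
  simpa [mollifier] using this

lemma exists_mollifier_bound (n : ℕ) : ∃ Q, ∀ x, |mollifier n x| ≤ Q :=
  (contDiff_mollifier n).continuous.bounded_above_of_compact_support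
    (shrinkingBump n).hasCompactSupport_normed

lemma exists_isFreqTest_mollifier (n : ℕ) (x : ℝ) :
    ∃ R Q, IsFreqTest (fun y => mollifier n (x - y)) R Q := by
  obtain ⟨Q, hQ⟩ := exists_mollifier_bound n
  refine ⟨|x| + 1, Q, (contDiff_mollifier n).comp (contDiff_const.sub contDiff_id), fun y hy => ?_,
    fun y => hQ _⟩
  refine mollifier_eq_zero n ?_
  have := abs_sub_abs_le_abs_sub y x
  rw [abs_sub_comm] at this
  linarith

lemma integral_mollifier_swap (n : ℕ) (c : ℝ → ℝ) (x : ℝ) :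
    ∫ y, mollifier n (x - y) * c y = ∫ y, mollifier n y * c (x - y) := by
  have := integral_sub_left_eq_self (fun y => mollifier n (x - y) * c y) volume x
  rw [← this]
  simp

lemma tendsto_integral_mollifier {c : ℝ → ℝ} (hc : Continuous c) (x : ℝ) :
    Tendsto (fun n => ∫ y, mollifier n (x - y) * c y) atTop (𝓝 (c x)) := by
  have := ContDiffBump.convolution_tendsto_right_of_continuous (μ := volume)
    tendsto_shrinkingBump_rOut hc x
  simp only [convolution_lsmul_swap, smul_eq_mul] at this
  exact this

lemma abs_integral_mollifier_mul_le (n : ℕ) {c : ℝ → ℝ} {Λ : ℝ} (hc : ∀ y, |c y| ≤ Λ) :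
    |∫ y, mollifier n y * c y| ≤ Λ := by
  rw [← Real.norm_eq_abs]
  refine (norm_integral_le_of_norm_le ((integrable_mollifier n).mul_const Λ)
    (Eventually.of_forall fun y => ?_)).trans ?_
  · rw [norm_mul, Real.norm_eq_abs, Real.norm_eq_abs, abs_of_nonneg (mollifier_nonneg n y)]
    exact mul_le_mul_of_nonneg_left (hc y) (mollifier_nonneg n y)
  · rw [integral_mul_const, integral_mollifier, one_mul]

/-- The integral of a function on the phase space over the angle. -/
def angularIntegral (f : Phase → ℝ) (ω : ℝ) : ℝ := ∫ θ : Torus, f (θ, ω)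

lemma torus_volume_real : (volume : Measure Torus).real univ = 2 * π := by
  rw [measureReal_def, AddCircle.measure_univ, ENNReal.toReal_ofReal Real.two_pi_pos.le]

lemma continuous_angularIntegral {f : Phase → ℝ} (hf : Continuous f) :
    Continuous (angularIntegral f) := by
  have := continuous_parametric_integral_of_continuous (μ := (volume : Measure Torus))
    (f := fun ω θ => f (θ, ω)) (hf.comp continuous_swap)
    isCompact_univ
  simp only [Measure.restrict_univ] at this
  exact this

lemma integral_mul_eq_integral_angularIntegral {f : Phase → ℝ} {φ : ℝ → ℝ}
    (hf : Integrable f) (hφ : Continuous φ) {Q : ℝ} (hQ : ∀ ω, |φ ω| ≤ Q) :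
    ∫ p, φ p.2 * f p = ∫ ω, φ ω * angularIntegral f ω := by
  have hi : Integrable (fun p : Phase => φ p.2 * f p) :=
    hf.bdd_mul (hφ.comp continuous_snd).aestronglyMeasurable
      (Eventually.of_forall fun p => hQ p.2)
  rw [Measure.volume_eq_prod] at hi ⊢
  rw [integral_prod_symm _ hi]
  simp only [integral_const_mul]
  rfl

lemma integral_densityMeasure {X : Type*} [MeasurableSpace X] (m : Measure X) {f : X → ℝ}
    (hf : Measurable f) (h0 : ∀ x, 0 ≤ f x) (ψ : X → ℝ) :
    ∫ x, ψ x ∂(densityMeasure m f) = ∫ x, ψ x * f x ∂m := by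
  rw [densityMeasure, integral_withDensity_eq_integral_toReal_smul hf.ennreal_ofReal
    (Eventually.of_forall fun _ => ENNReal.ofReal_lt_top)]
  refine integral_congr_ae (Eventually.of_forall fun x => ?_)
  simp only [ENNReal.toReal_ofReal (h0 x), smul_eq_mul, mul_comm]

lemma integrable_of_isFiniteMeasure_densityMeasure {X : Type*} [MeasurableSpace X]
    {m : Measure X} {f : X → ℝ} (hf : Measurable f) (h0 : ∀ x, 0 ≤ f x)
    (h : IsFiniteMeasure (densityMeasure m f)) : Integrable f m := by
  refine (lintegral_ofReal_ne_top_iff_integrable hf.aestronglyMeasurable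
    (Eventually.of_forall h0)).1 ?_
  have := h.measure_univ_lt_top
  rw [densityMeasure, withDensity_apply _ MeasurableSet.univ, Measure.restrict_univ] at this
  exact this.ne

section Density

variable {K T : ℝ} {γ : Measure ℝ} {ρ : ℝ → Phase → ℝ}

lemma IsDensitySolution.integrable (h : IsDensitySolution K T γ ρ) {t : ℝ} (ht : t ∈ Icc 0 T) :
    Integrable (ρ t) :=
  integrable_of_isFiniteMeasure_densityMeasure (h.continuous t ht).measurable (h.nonneg t ht)
    (h.weak.finite t ht)

lemma IsDensitySolution.integral_eq (h : IsDensitySolution K T γ ρ) {t : ℝ} (ht : t ∈ Icc 0 T)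
    {φ : ℝ → ℝ} (hφ : Continuous φ) {Q : ℝ} (hQ : ∀ ω, |φ ω| ≤ Q) {k : Phase → ℝ}
    (hk : Continuous k) (hk1 : ∀ p, |k p| ≤ 1) :
    ∫ p, φ p.2 * k p ∂(densityMeasure volume (ρ t)) =
      ∫ ω, φ ω * angularIntegral (fun p => k p * ρ t p) ω := by
  rw [integral_densityMeasure _ (h.continuous t ht).measurable (h.nonneg t ht)]
  rw [← integral_mul_eq_integral_angularIntegral ((h.integrable ht).bdd_mul
    hk.aestronglyMeasurable (Eventually.of_forall hk1)) hφ hQ]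
  simp only [mul_assoc]

lemma IsDensitySolution.angularIntegral_eq (h : IsDensitySolution K T γ ρ) {t : ℝ}
    (ht : t ∈ Icc 0 T) (ω : ℝ) : angularIntegral (ρ t) ω = angularIntegral (ρ 0) ω := by
  have h0 : (0 : ℝ) ∈ Icc 0 T := ⟨le_rfl, ht.1.trans ht.2⟩
  refine tendsto_nhds_unique
    (tendsto_integral_mollifier (continuous_angularIntegral (h.continuous t ht)) ω)
    ((tendsto_integral_mollifier (continuous_angularIntegral (h.continuous 0 h0)) ω).congr
      fun n => ?_)
  obtain ⟨R, Q, hφ⟩ := exists_isFreqTest_mollifier n ω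
  have e := h.weak.integral_freq_eq hφ.contDiff hφ.eq_zero ht
  have key : ∀ s ∈ Icc 0 T, ∫ p : Phase, mollifier n (ω - p.2) ∂(densityMeasure volume (ρ s)) =
      ∫ y, mollifier n (ω - y) * angularIntegral (ρ s) y := fun s hs => by
    simpa using h.integral_eq hs hφ.contDiff.continuous hφ.bound (k := fun _ => 1)
      continuous_const (by simp)
  rw [← key 0 h0, ← key t ht]
  exact e.symm

lemma abs_angularIntegral_le {f : Phase → ℝ} {Λ : ℝ} (hf : ∀ p, |f p| ≤ Λ) (ω : ℝ) :
    |angularIntegral f ω| ≤ 2 * π * Λ := by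
  have := abs_integral_le_of_bound (σ := (volume : Measure Torus)) fun θ => hf (θ, ω)
  rw [torus_volume_real] at this
  exact this.trans_eq (mul_comm _ _)

lemma integrable_slice {f : Phase → ℝ} (hf : Continuous f) (ω : ℝ) :
    Integrable (fun θ : Torus => f (θ, ω)) :=
  (hf.comp (continuous_id.prodMk continuous_const)).integrable_of_hasCompactSupport
    (HasCompactSupport.of_compactSpace _)

lemma IsDensitySolution.abs_angularIntegral_mul_le (h : IsDensitySolution K T γ ρ)
    (hρ : ∀ p, |ρ 0 p| ≤ 1) {t : ℝ} (ht : t ∈ Icc 0 T) {k : Phase → ℝ}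
    (hk1 : ∀ p, |k p| ≤ 1) (ω : ℝ) :
    |angularIntegral (fun p => k p * ρ t p) ω| ≤ 2 * π := by
  have h1 : |angularIntegral (fun p => k p * ρ t p) ω| ≤ angularIntegral (ρ t) ω := by
    rw [angularIntegral, ← Real.norm_eq_abs]
    refine norm_integral_le_of_norm_le (integrable_slice (h.continuous t ht) ω)
      (Eventually.of_forall fun θ => ?_)
    rw [norm_mul, Real.norm_eq_abs, Real.norm_eq_abs, abs_of_nonneg (h.nonneg t ht _)]
    exact mul_le_of_le_one_left (h.nonneg t ht _) (hk1 _)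
  rw [h.angularIntegral_eq ht] at h1
  refine h1.trans ((le_abs_self _).trans ?_)
  simpa using abs_angularIntegral_le hρ ω

lemma IsDensitySolution.integrable_prod (h : IsDensitySolution K T γ ρ) [IsFiniteMeasure γ]
    (hρ : ∀ p, |ρ 0 p| ≤ 1) {t : ℝ} (ht : t ∈ Icc 0 T) :
    Integrable (ρ t) ((volume : Measure Torus).prod γ) := by
  have hc := h.continuous t ht
  rw [integrable_prod_iff' hc.aestronglyMeasurable]
  refine ⟨Eventually.of_forall fun ω => integrable_slice hc ω, ?_⟩
  have e : (fun ω => ∫ θ : Torus, ‖ρ t (θ, ω)‖) = angularIntegral (ρ t) := by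
    funext ω
    simp only [Real.norm_eq_abs, abs_of_nonneg (h.nonneg t ht _)]
    rfl
  rw [e]
  refine integrable_of_continuous_bounded (continuous_angularIntegral hc) (C := 2 * π) fun ω => ?_
  simpa using h.abs_angularIntegral_mul_le hρ ht (k := fun _ => 1) (by simp) ω

lemma IsDensitySolution.integral_weightByMeasure (h : IsDensitySolution K T γ ρ)
    [IsFiniteMeasure γ] (hρ : ∀ p, |ρ 0 p| ≤ 1) {t : ℝ} (ht : t ∈ Icc 0 T) {k : Phase → ℝ}
    (hk : Continuous k) (hk1 : ∀ p, |k p| ≤ 1) :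
    ∫ p, k p ∂(weightByMeasure γ (ρ t)) =
      ∫ ω, angularIntegral (fun p => k p * ρ t p) ω ∂γ := by
  rw [weightByMeasure, integral_densityMeasure _ (h.continuous t ht).measurable (h.nonneg t ht)]
  exact integral_prod_symm _ ((h.integrable_prod hρ ht).bdd_mul hk.aestronglyMeasurable
    (Eventually.of_forall hk1))

lemma IsDensitySolution.isFiniteMeasure_weight (h : IsDensitySolution K T γ ρ)
    [IsFiniteMeasure γ] (hρ : ∀ p, |ρ 0 p| ≤ 1) {t : ℝ} (ht : t ∈ Icc 0 T) :
    IsFiniteMeasure (weightByMeasure γ (ρ t)) :=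
  isFiniteMeasure_withDensity_ofReal (h.integrable_prod hρ ht).hasFiniteIntegral

lemma IsDensitySolution.weight_univ_le (h : IsDensitySolution K T γ ρ)
    [IsFiniteMeasure γ] (hρ : ∀ p, |ρ 0 p| ≤ 1) {t : ℝ} (ht : t ∈ Icc 0 T) :
    (weightByMeasure γ (ρ t)).real univ ≤ 2 * π * γ.real univ := by
  have := h.isFiniteMeasure_weight hρ ht
  have e := h.integral_weightByMeasure hρ ht (k := fun _ => 1) continuous_const (by simp)
  have e2 := abs_integral_le_of_bound (σ := γ)
    fun ω => h.abs_angularIntegral_mul_le hρ ht (k := fun _ => 1) (by simp) ω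
  rw [← e] at e2
  simpa using (le_abs_self _).trans e2

lemma IsDensitySolution.aestronglyMeasurable_integral (h : IsDensitySolution K T γ ρ)
    [IsFiniteMeasure γ] (hρ : ∀ p, |ρ 0 p| ≤ 1) {k : Phase → ℝ}
    (hk : Continuous k) (hk1 : ∀ p, |k p| ≤ 1) :
    AEStronglyMeasurable (fun t => ∫ p, k p ∂(weightByMeasure γ (ρ t)))
      (volume.restrict (Icc 0 T)) := by
  set Γ : ℕ → ℝ → ℝ := fun n y => ∫ ω, mollifier n (ω - y) ∂γ with hΓ
  choose Q hQ using exists_mollifier_bound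
  have hmc : ∀ n, Continuous (mollifier n) := fun n => (contDiff_mollifier n).continuous
  have hΓc : ∀ n, Continuous (Γ n) := fun n => by
    refine continuous_of_dominated (bound := fun _ => Q n) (fun y => ?_)
      (fun y => Eventually.of_forall fun ω => hQ n _) (integrable_const _)
      (Eventually.of_forall fun ω => (hmc n).comp (continuous_const.sub continuous_id))
    exact ((hmc n).comp (continuous_id.sub continuous_const)).aestronglyMeasurable
  have hΓb : ∀ n y, |Γ n y| ≤ Q n * γ.real univ := fun n y =>
    abs_integral_le_of_bound fun ω => hQ n _
  refine aestronglyMeasurable_of_tendsto_ae atTop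
    (f := fun n t => ∫ p : Phase, Γ n p.2 * k p ∂(densityMeasure volume (ρ t))) (fun n => ?_) ?_
  · refine (h.weak.continuousOn_integral (((hΓc n).comp continuous_snd).mul hk)
      (Q := Q n * γ.real univ) fun p => ?_).aestronglyMeasurable measurableSet_Icc
    change |Γ n p.2 * k p| ≤ _
    rw [abs_mul]
    exact (mul_le_of_le_one_right (abs_nonneg _) (hk1 p)).trans (hΓb n p.2)
  · rw [ae_restrict_iff' measurableSet_Icc]
    refine Eventually.of_forall fun t ht => ?_
    rw [h.integral_weightByMeasure hρ ht hk hk1]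
    have hcc : Continuous (angularIntegral fun p => k p * ρ t p) :=
      continuous_angularIntegral (hk.mul (h.continuous t ht))
    have hci : Integrable (angularIntegral fun p => k p * ρ t p) := by
      have : Integrable (fun p => k p * ρ t p) :=
        (h.integrable ht).bdd_mul hk.aestronglyMeasurable (Eventually.of_forall hk1)
      rw [Measure.volume_eq_prod] at this
      exact this.integral_prod_right
    set c := angularIntegral fun p => k p * ρ t p
    have hcb : ∀ ω, |c ω| ≤ 2 * π := h.abs_angularIntegral_mul_le hρ ht hk1
    have e : ∀ n, ∫ p : Phase, Γ n p.2 * k p ∂(densityMeasure volume (ρ t)) =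
        ∫ ω, (∫ y, mollifier n (ω - y) * c y) ∂γ := fun n => by
      rw [h.integral_eq ht (hΓc n) (hΓb n) hk hk1]
      have hint : Integrable (Function.uncurry fun (ω y : ℝ) => mollifier n (ω - y) * c y)
          (γ.prod volume) := by
        have h1 : Integrable (fun z : ℝ × ℝ => (1 : ℝ) * c z.2) (γ.prod volume) :=
          Integrable.mul_prod (integrable_const 1) hci
        simp only [one_mul] at h1
        exact h1.bdd_mul ((hmc n).comp (continuous_fst.sub continuous_snd)).aestronglyMeasurable
          (Eventually.of_forall fun z => hQ n _)
      rw [integral_integral_swap hint]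
      simp only [hΓ, integral_mul_const]
      rfl
    simp only [e]
    refine tendsto_integral_of_dominated_convergence (fun _ => 2 * π) (fun n => ?_)
      (integrable_const _) (fun n => Eventually.of_forall fun ω => ?_)
      (Eventually.of_forall fun ω => tendsto_integral_mollifier hcc ω)
    · refine Continuous.aestronglyMeasurable ?_
      refine continuous_of_dominated (bound := fun y => Q n * |c y|) (fun ω => ?_)
        (fun ω => Eventually.of_forall fun y => ?_) (hci.abs.const_mul _)
        (Eventually.of_forall fun y =>
          ((hmc n).comp (continuous_id.sub continuous_const)).mul continuous_const)
      · exact (((hmc n).comp (continuous_const.sub continuous_id)).mul hcc).aestronglyMeasurable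
      · rw [norm_mul]
        exact mul_le_mul_of_nonneg_right (hQ n _) (norm_nonneg _)
    · rw [integral_mollifier_swap]
      exact abs_integral_mollifier_mul_le n fun y => hcb _

end Density

section MeasureSolution

variable {K T B M : ℝ} {g : ℝ → ℝ} {μ : ℝ → Measure Phase}

lemma continuous_of_admissible {g : ℝ → ℝ} (hg : g ∈ admissible fun x y : ℝ => dist x y) :
    Continuous g :=
  (LipschitzWith.of_dist_le_mul (K := 1) fun x y => by
    simpa [Real.dist_eq] using hg.2 x y).continuous

lemma integral_weightByDensity (hg : g ∈ admissible fun x y : ℝ => dist x y)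
    (hg0 : ∀ ω, 0 ≤ g ω) (ν : Measure Phase) (k : Phase → ℝ) :
    ∫ p, k p ∂(weightByDensity g ν) = ∫ p, g p.2 * k p ∂ν := by
  rw [weightByDensity, integral_densityMeasure ν (f := fun p : Phase => g p.2)
    ((continuous_of_admissible hg).comp continuous_snd).measurable fun p => hg0 p.2]
  simp only [mul_comm]

lemma isFiniteMeasure_weightByDensity (hg : g ∈ admissible fun x y : ℝ => dist x y)
    (ν : Measure Phase) [IsFiniteMeasure ν] : IsFiniteMeasure (weightByDensity g ν) :=
  isFiniteMeasure_withDensity_ofReal (integrable_of_continuous_bounded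
    ((continuous_of_admissible hg).comp continuous_snd) fun p => hg.1 p.2).hasFiniteIntegral

lemma weightByDensity_univ_le (hg : g ∈ admissible fun x y : ℝ => dist x y)
    (hg0 : ∀ ω, 0 ≤ g ω) (ν : Measure Phase) [IsFiniteMeasure ν] :
    (weightByDensity g ν).real univ ≤ ν.real univ := by
  have := isFiniteMeasure_weightByDensity hg ν
  have e := integral_weightByDensity hg hg0 ν fun _ => 1
  have e2 := abs_integral_le_of_bound (σ := ν) (f := fun p => g p.2 * 1) (C := 1)
    fun p => by simpa using hg.1 p.2
  rw [← e] at e2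
  simpa using (le_abs_self _).trans e2

lemma IsMeasureSolution.isTransported (h : IsMeasureSolution K T g μ)
    (hg : g ∈ admissible fun x y : ℝ => dist x y) (hg0 : ∀ ω, 0 ≤ g ω)
    (hM : (μ 0).real univ ≤ M) (hMB : M ≤ B) :
    IsTransported K T B M μ (fun t => cosMean (weightByDensity g (μ t)))
      (fun t => sinMean (weightByDensity g (μ t))) := by
  have hmeas : ∀ k : Phase → ℝ, Continuous k → (∀ p, |k p| ≤ 1) →
      AEStronglyMeasurable (fun t => ∫ p, k p ∂(weightByDensity g (μ t)))
        (volume.restrict (Icc 0 T)) := fun k hk hk1 => by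
    simp only [integral_weightByDensity hg hg0]
    refine (IsWeakSolution.continuousOn_integral h (Q := 1)
      (((continuous_of_admissible hg).comp continuous_snd).mul hk)
      fun p => ?_).aestronglyMeasurable measurableSet_Icc
    change |g p.2 * k p| ≤ 1
    rw [abs_mul]
    exact mul_le_one₀ (hg.1 p.2) (abs_nonneg _) (hk1 p)
  refine IsWeakSolution.isTransported h (fun t ht => ?_)
    (hmeas _ (continuous_torusCos.comp continuous_fst) fun p => abs_torusCos_le p.1)
    (hmeas _ (continuous_torusSin.comp continuous_fst) fun p => abs_torusSin_le p.1)
    (fun t ht => ?_) hM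
  · have := h.finite t ht
    exact isFiniteMeasure_weightByDensity hg _
  · have := h.finite t ht
    exact (weightByDensity_univ_le hg hg0 _).trans ((h.measure_univ_eq ht).trans_le (hM.trans hMB))

end MeasureSolution

section DensitySolution

variable {K T B : ℝ} {γ : Measure ℝ} {ρ : ℝ → Phase → ℝ}

lemma IsDensitySolution.isTransported (h : IsDensitySolution K T γ ρ) [IsFiniteMeasure γ]
    (hρ : ∀ p, |ρ 0 p| ≤ 1) (hB : 2 * π * γ.real univ ≤ B) :
    IsTransported K T B ((densityMeasure volume (ρ 0)).real univ)
      (fun t => densityMeasure volume (ρ t)) (fun t => cosMean (weightByMeasure γ (ρ t)))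
      (fun t => sinMean (weightByMeasure γ (ρ t))) :=
  h.weak.isTransported (fun _ ht => h.isFiniteMeasure_weight hρ ht)
    (h.aestronglyMeasurable_integral hρ (continuous_torusCos.comp continuous_fst)
      fun p => abs_torusCos_le p.1)
    (h.aestronglyMeasurable_integral hρ (continuous_torusSin.comp continuous_fst)
      fun p => abs_torusSin_le p.1)
    (fun _ ht => (h.weight_univ_le hρ ht).trans hB) le_rfl

lemma abs_sub_le_of_admissible {f : Phase → ℝ} (hf : f ∈ admissible phaseDist) (θ : Torus)
    (ω ω' : ℝ) : |f (θ, ω) - f (θ, ω')| ≤ |ω - ω'| := by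
  have := hf.2 (θ, ω) (θ, ω')
  simpa [phaseDist, Real.sqrt_sq_eq_abs, Real.dist_eq] using this

lemma continuous_of_phaseAdmissible {f : Phase → ℝ} (hf : f ∈ admissible phaseDist) :
    Continuous f := by
  refine (LipschitzWith.of_dist_le_mul (K := 2) fun p q => ?_).continuous
  rw [Real.dist_eq]
  refine (hf.2 p q).trans ?_
  have h1 : dist p.1 q.1 ≤ dist p q := le_max_left _ _
  have h2 : dist p.2 q.2 ≤ dist p q := le_max_right _ _
  have h3 : 0 ≤ dist p q := dist_nonneg
  refine Real.sqrt_le_iff.2 ⟨by positivity, ?_⟩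
  have := pow_le_pow_left₀ dist_nonneg h1 2
  have := pow_le_pow_left₀ dist_nonneg h2 2
  push_cast
  nlinarith

lemma abs_angularIntegral_mul_sub_le {k k' : Torus → ℝ → ℝ} {A L : ℝ}
    (hk : IsObservable k k' A L) {f : Phase → ℝ} (hf : f ∈ admissible phaseDist) (ω ω' : ℝ) :
    |angularIntegral (fun p => k p.1 p.2 * f p) ω -
        angularIntegral (fun p => k p.1 p.2 * f p) ω'| ≤ 2 * π * (L + 1) * |ω - ω'| := by
  have hc : Continuous fun p : Phase => k p.1 p.2 * f p :=
    hk.continuous.mul (continuous_of_phaseAdmissible hf)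
  rw [angularIntegral, angularIntegral, ← integral_sub (integrable_slice hc ω)
    (integrable_slice hc ω')]
  refine (abs_integral_le_of_bound (C := (L + 1) * |ω - ω'|) fun θ => ?_).trans_eq ?_
  · have e : k θ ω * f (θ, ω) - k θ ω' * f (θ, ω') =
        (k θ ω - k θ ω') * f (θ, ω) + k θ ω' * (f (θ, ω) - f (θ, ω')) := by ring
    simp only [e]
    refine (abs_add_le _ _).trans ?_
    rw [abs_mul, abs_mul, add_mul, one_mul]
    refine add_le_add ?_ ?_
    · exact (mul_le_of_le_one_right (abs_nonneg _) (hf.1 _)).trans (hk.freq_lipschitz _ _ _)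
    · exact (mul_le_of_le_one_left (abs_nonneg _) (hk.abs_le_one _ _)).trans
        (abs_sub_le_of_admissible hf _ _ _)
  · rw [torus_volume_real]; ring

lemma IsDensitySolution.angularIntegral_lipschitz (h : IsDensitySolution K T γ ρ)
    [IsFiniteMeasure γ] (hρ : ρ 0 ∈ admissible phaseDist) (hK : 0 ≤ K)
    (hB : 2 * π * γ.real univ ≤ B) {k k' : Torus → ℝ → ℝ} (hk : IsObservable k k' 1 0)
    {t : ℝ} (ht : t ∈ Icc 0 T) (ω ω' : ℝ) :
    |angularIntegral (fun p => k p.1 p.2 * ρ t p) ω -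
        angularIntegral (fun p => k p.1 p.2 * ρ t p) ω'| ≤
      2 * π * (T * exp (8 * K * B * T) + 1) * |ω - ω'| := by
  have htr := h.isTransported hρ.1 hB
  have hB0 : 0 ≤ B := le_trans (by positivity) hB
  have h0 : (0 : ℝ) ∈ Icc 0 T := ⟨le_rfl, ht.1.trans ht.2⟩
  have happ := exists_observable_approx hK hB0
    (integrableOn_Icc_of_bound htr.measurable_cos htr.abs_cos_le)
    (integrableOn_Icc_of_bound htr.measurable_sin htr.abs_sin_le) htr.abs_cos_le htr.abs_sin_le
    ht hk
  have hcc : Continuous (angularIntegral fun p => k p.1 p.2 * ρ t p) :=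
    continuous_angularIntegral (hk.continuous.mul (h.continuous t ht))
  set c := angularIntegral fun p => k p.1 p.2 * ρ t p
  refine le_of_tendsto' ((tendsto_integral_mollifier hcc ω).sub
    (tendsto_integral_mollifier hcc ω')).abs fun n => ?_
  obtain ⟨R₁, Q₁, hφ₁⟩ := exists_isFreqTest_mollifier n ω
  obtain ⟨R₂, Q₂, hφ₂⟩ := exists_isFreqTest_mollifier n ω'
  set m := (densityMeasure volume (ρ 0)).real univ
  set Â := exp (8 * K * B * T)
  have hlim : Tendsto (fun N : ℕ => (Q₁ * Â * m * (3 * (|R₁| + 2 * K * B) ^ 2 * (t ^ 2 / N)) +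
      Q₂ * Â * m * (3 * (|R₂| + 2 * K * B) ^ 2 * (t ^ 2 / N))) +
      2 * π * (T * Â + 1) * |ω - ω'|) atTop (𝓝 (2 * π * (T * Â + 1) * |ω - ω'|)) := by
    have hN := tendsto_const_div_atTop_nhds_zero_nat (t ^ 2)
    simpa using (((hN.const_mul (3 * (|R₁| + 2 * K * B) ^ 2)).const_mul (Q₁ * Â * m)).add
      ((hN.const_mul (3 * (|R₂| + 2 * K * B) ^ 2)).const_mul (Q₂ * Â * m))).add_const
      (2 * π * (T * Â + 1) * |ω - ω'|)
  refine ge_of_tendsto hlim ?_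
  filter_upwards [happ] with N hN
  obtain ⟨k₀, k₀', hk₀, hb⟩ := hN
  have b1 := hb _ _ _ _ htr _ _ _ hφ₁
  have b2 := hb _ _ _ _ htr _ _ _ hφ₂
  simp only [sub_self, abs_zero, add_zero, intervalIntegral.integral_zero, mul_zero] at b1 b2
  rw [h.integral_eq ht hφ₁.contDiff.continuous hφ₁.bound hk.continuous
      fun p => hk.abs_le_one p.1 p.2,
    h.integral_eq h0 hφ₁.contDiff.continuous hφ₁.bound hk₀.continuous
      fun p => hk₀.abs_le_one p.1 p.2] at b1
  rw [h.integral_eq ht hφ₂.contDiff.continuous hφ₂.bound hk.continuous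
      fun p => hk.abs_le_one p.1 p.2,
    h.integral_eq h0 hφ₂.contDiff.continuous hφ₂.bound hk₀.continuous
      fun p => hk₀.abs_le_one p.1 p.2] at b2
  set e := angularIntegral fun p => k₀ p.1 p.2 * ρ 0 p with he
  have hec : Continuous e :=
    continuous_angularIntegral (hk₀.continuous.mul (continuous_of_phaseAdmissible hρ))
  have heb : ∀ y, |e y| ≤ 2 * π :=
    h.abs_angularIntegral_mul_le hρ.1 h0 fun p => hk₀.abs_le_one p.1 p.2
  have b3 : |(∫ y, mollifier n (ω - y) * e y) - ∫ y, mollifier n (ω' - y) * e y| ≤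
      2 * π * (T * Â + 1) * |ω - ω'| := by
    have hi : ∀ x : ℝ, Integrable fun y => mollifier n y * e (x - y) := fun x => by
      have := (integrable_mollifier n).bdd_mul (f := fun y => e (x - y))
        (hec.comp (continuous_const.sub continuous_id)).aestronglyMeasurable
        (Eventually.of_forall fun y => heb _)
      simpa only [mul_comm] using this
    rw [integral_mollifier_swap, integral_mollifier_swap, ← integral_sub (hi ω) (hi ω')]
    simp only [← mul_sub]
    refine abs_integral_mollifier_mul_le n fun y => ?_
    have := abs_angularIntegral_mul_sub_le hk₀ hρ (ω - y) (ω' - y)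
    rwa [sub_sub_sub_cancel_right] at this
  have tri : ∀ a b c d : ℝ, |a - b| ≤ |a - c| + |b - d| + |c - d| := fun a b c d => by
    have e : a - b = (a - c) - (b - d) + (c - d) := by ring
    rw [e]
    exact (abs_add_le _ _).trans (add_le_add_left (abs_sub _ _) _)
  exact (tri _ _ _ _).trans (add_le_add (add_le_add b1 b2) b3)

end DensitySolution

lemma exists_freqTest_approx {g : ℝ → ℝ} (hg : g ∈ admissible fun x y : ℝ => dist x y) :
    ∃ φ : ℕ → ℝ → ℝ, (∀ m, ∃ R, IsFreqTest (φ m) R 1) ∧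
      (∀ m x y, |φ m x - φ m y| ≤ 2 * |x - y|) ∧
      ∀ x, Tendsto (fun m => φ m x) atTop (𝓝 (g x)) := by
  have hgc := continuous_of_admissible hg
  let b : ContDiffBump (0 : ℝ) := ⟨1, 2, one_pos, one_lt_two⟩
  obtain ⟨Lb, hLb⟩ := (b.contDiff (n := 1)).lipschitzWith_of_hasCompactSupport
    b.hasCompactSupport one_ne_zero
  obtain ⟨m₀, hm₀⟩ := exists_nat_ge (Lb : ℝ)
  have hi : ∀ m (x : ℝ), Integrable fun y => mollifier m y * g (x - y) := fun m x => by
    have := (integrable_mollifier m).bdd_mul (f := fun y => g (x - y))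
      (hgc.comp (continuous_const.sub continuous_id)).aestronglyMeasurable
      (Eventually.of_forall fun y => hg.1 _)
    simpa only [mul_comm] using this
  set G : ℕ → ℝ → ℝ := fun m x => ∫ y, mollifier m (x - y) * g y with hG
  have hG1 : ∀ m x, |G m x| ≤ 1 := fun m x => by
    simp only [hG, integral_mollifier_swap]
    exact abs_integral_mollifier_mul_le m fun y => hg.1 _
  have hGl : ∀ m x y, |G m x - G m y| ≤ |x - y| := fun m x y => by
    simp only [hG, integral_mollifier_swap]
    rw [← integral_sub (hi m x) (hi m y)]
    simp only [← mul_sub]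
    refine abs_integral_mollifier_mul_le m fun z => ?_
    have := hg.2 (x - z) (y - z)
    simp only [Real.dist_eq, sub_sub_sub_cancel_right] at this
    exact this
  have hGc : ∀ m, ContDiff ℝ 1 (G m) := fun m => by
    have := (shrinkingBump m).hasCompactSupport_normed.contDiff_convolution_left
      (ContinuousLinearMap.lsmul ℝ ℝ) (contDiff_mollifier m) (μ := volume) hgc.locallyIntegrable
    have e : G m = convolution (mollifier m) g (ContinuousLinearMap.lsmul ℝ ℝ) volume := by
      funext x
      rw [convolution_lsmul_swap]
      rfl
    rw [e]
    exact this
  have hpos : ∀ m : ℕ, (0 : ℝ) < m + m₀ + 1 := fun m => by positivity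
  refine ⟨fun m x => b (x / (m + m₀ + 1)) * G m x, fun m => ⟨2 * (m + m₀ + 1), ?_, ?_, ?_⟩,
    fun m x y => ?_, fun x => ?_⟩
  · exact (b.contDiff.comp (contDiff_id.div_const _)).mul (hGc m)
  · intro x hx
    change b (x / (m + m₀ + 1)) * G m x = 0
    rw [b.zero_of_le_dist, zero_mul]
    rw [dist_zero_right, Real.norm_eq_abs, abs_div, abs_of_pos (hpos m), le_div_iff₀ (hpos m)]
    exact hx.le
  · intro x
    change |b (x / (m + m₀ + 1)) * G m x| ≤ 1
    rw [abs_mul, abs_of_nonneg b.nonneg]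
    exact mul_le_one₀ b.le_one (abs_nonneg _) (hG1 m x)
  · have e : b (x / (m + m₀ + 1)) * G m x - b (y / (m + m₀ + 1)) * G m y =
        (b (x / (m + m₀ + 1)) - b (y / (m + m₀ + 1))) * G m x +
          b (y / (m + m₀ + 1)) * (G m x - G m y) := by ring
    rw [e]
    refine (abs_add_le _ _).trans ?_
    rw [abs_mul, abs_mul, abs_of_nonneg b.nonneg, two_mul]
    refine add_le_add ((mul_le_of_le_one_right (abs_nonneg _) (hG1 m x)).trans ?_)
      ((mul_le_of_le_one_left (abs_nonneg _) b.le_one).trans (hGl m x y))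
    have h1 := hLb.dist_le_mul (x / (m + m₀ + 1)) (y / (m + m₀ + 1))
    rw [Real.dist_eq, Real.dist_eq, ← sub_div, abs_div, abs_of_pos (hpos m)] at h1
    refine h1.trans ?_
    rw [mul_div_assoc', div_le_iff₀ (hpos m), mul_comm]
    refine mul_le_mul_of_nonneg_left ?_ (abs_nonneg _)
    have : (0 : ℝ) ≤ m := Nat.cast_nonneg m
    linarith
  · have h1 : Tendsto (fun m : ℕ => b (x / (m + m₀ + 1))) atTop (𝓝 1) := by
      refine tendsto_const_nhds.congr' ?_
      obtain ⟨N, hN⟩ := exists_nat_ge |x|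
      filter_upwards [eventually_ge_atTop N] with m hm
      refine (b.one_of_mem_closedBall ?_).symm
      have h2 : (N : ℝ) ≤ m := by exact_mod_cast hm
      have h3 : (0 : ℝ) ≤ m₀ := Nat.cast_nonneg m₀
      rw [Metric.mem_closedBall, dist_zero_right, Real.norm_eq_abs, abs_div, abs_of_pos (hpos m)]
      change |x| / _ ≤ 1
      rw [div_le_one (hpos m)]
      linarith
    simpa using h1.mul (tendsto_integral_mollifier hgc x)

lemma tendsto_integral_of_freqTest {φ : ℕ → ℝ → ℝ} {g : ℝ → ℝ}
    (hφ : ∀ m, ∃ R, IsFreqTest (φ m) R 1) (hlim : ∀ x, Tendsto (fun m => φ m x) atTop (𝓝 (g x)))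
    (ν : Measure Phase) [IsFiniteMeasure ν] {k : Phase → ℝ} (hk : Continuous k)
    (hk1 : ∀ p, |k p| ≤ 1) :
    Tendsto (fun m => ∫ p, φ m p.2 * k p ∂ν) atTop (𝓝 (∫ p, g p.2 * k p ∂ν)) := by
  refine tendsto_integral_of_dominated_convergence (fun _ => 1) (fun m => ?_) (integrable_const _)
    (fun m => Eventually.of_forall fun p => ?_) (Eventually.of_forall fun p => ?_)
  · obtain ⟨R, h⟩ := hφ m
    exact ((h.contDiff.continuous.comp continuous_snd).mul hk).aestronglyMeasurable
  · obtain ⟨R, h⟩ := hφ m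
    rw [Real.norm_eq_abs, abs_mul]
    exact mul_le_one₀ (h.bound _) (abs_nonneg _) (hk1 p)
  · exact (hlim p.2).mul_const _

lemma IsObservable.abs_sub_le_dist {k k' : Torus → ℝ → ℝ} {A L : ℝ} (h : IsObservable k k' A L)
    (θ η : Torus) (ω : ℝ) : |k θ ω - k η ω| ≤ A * dist θ η := by
  obtain ⟨x, y, rfl, rfl, hxy⟩ := exists_coe_dist θ η
  rw [← hxy]
  exact h.abs_sub_le_lift x y ω

lemma abs_freq_mul_observable_sub_le {k k' : Torus → ℝ → ℝ} {A L : ℝ}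
    (hk : IsObservable k k' A L) (hL : 0 ≤ L) {φ : ℝ → ℝ} (hφ1 : ∀ ω, |φ ω| ≤ 1)
    (hφ : ∀ x y, |φ x - φ y| ≤ 2 * |x - y|) (p q : Phase) :
    |φ p.2 * k p.1 p.2 - φ q.2 * k q.1 q.2| ≤ (2 + A + L) * phaseDist p q := by
  have d1 := dist_fst_le_phaseDist p q
  have d2 := dist_snd_le_phaseDist p q
  rw [Real.dist_eq] at d2
  have e : φ p.2 * k p.1 p.2 - φ q.2 * k q.1 q.2 = (φ p.2 - φ q.2) * k p.1 p.2 +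
      (φ q.2 * (k p.1 p.2 - k q.1 p.2) + φ q.2 * (k q.1 p.2 - k q.1 q.2)) := by ring
  have h1 : |(φ p.2 - φ q.2) * k p.1 p.2| ≤ 2 * phaseDist p q := by
    rw [abs_mul]
    exact (mul_le_of_le_one_right (abs_nonneg _) (hk.abs_le_one _ _)).trans
      ((hφ _ _).trans (by linarith))
  have h2 : |φ q.2 * (k p.1 p.2 - k q.1 p.2)| ≤ A * phaseDist p q := by
    rw [abs_mul]
    exact (mul_le_of_le_one_left (abs_nonneg _) (hφ1 _)).trans
      ((hk.abs_sub_le_dist _ _ _).trans (mul_le_mul_of_nonneg_left d1 hk.nonneg))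
  have h3 : |φ q.2 * (k q.1 p.2 - k q.1 q.2)| ≤ L * phaseDist p q := by
    rw [abs_mul]
    exact (mul_le_of_le_one_left (abs_nonneg _) (hφ1 _)).trans
      ((hk.freq_lipschitz _ _ _).trans (mul_le_mul_of_nonneg_left d2 hL))
  rw [e]
  refine (abs_add_le _ _).trans ((add_le_add h1 ((abs_add_le _ _).trans
    (add_le_add h2 h3))).trans (le_of_eq ?_))
  ring

lemma le_exp_of_le_integral {D : ℝ → ℝ} {T a b : ℝ} (hD : IntegrableOn D (Icc 0 T))
    (hb : 0 ≤ b) (ha : 0 ≤ a) (hD0 : ∀ t ∈ Icc 0 T, 0 ≤ D t)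
    (h : ∀ t ∈ Icc 0 T, D t ≤ a + b * ∫ s in (0 : ℝ)..t, D s) :
    ∀ t ∈ Icc 0 T, D t ≤ a * exp (b * t) := by
  set E : ℝ → ℝ := (Icc 0 T).indicator D with hE
  have hEi : Integrable E := (integrable_indicator_iff measurableSet_Icc).2 hD
  have hE0 : ∀ s, 0 ≤ E s := fun s => indicator_nonneg hD0 s
  have hEeq : ∀ t ∈ Icc 0 T, ∫ s in (0 : ℝ)..t, D s = ∫ s in (0 : ℝ)..t, E s := fun t ht => by
    refine intervalIntegral.integral_congr fun s hs => ?_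
    rw [uIcc_of_le ht.1] at hs
    rw [hE, indicator_of_mem (show s ∈ Icc 0 T from ⟨hs.1, hs.2.trans ht.2⟩)]
  set G : ℝ → ℝ := fun t => a + b * ∫ s in (0 : ℝ)..t, E s with hG
  have hGc : Continuous G := continuous_const.add (continuous_const.mul
    (intervalIntegral.continuous_primitive (fun x y => hEi.intervalIntegrable) 0))
  have hDG : ∀ t ∈ Icc 0 T, D t ≤ G t := fun t ht => by
    have := h t ht
    rwa [hEeq t ht] at this
  set H : ℝ → ℝ := fun t => a + b * ∫ s in (0 : ℝ)..t, G s with hH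
  have hHd : ∀ t, HasDerivAt H (b * G t) t := fun t =>
    ((intervalIntegral.integral_hasDerivAt_right (hGc.intervalIntegrable 0 t)
      (hGc.stronglyMeasurableAtFilter _ _) hGc.continuousAt).const_mul b).const_add a
  have hGH : ∀ t ∈ Icc 0 T, G t ≤ H t := fun t ht => by
    refine add_le_add_right (mul_le_mul_of_nonneg_left ?_ hb) a
    refine intervalIntegral.integral_mono_on ht.1 hEi.intervalIntegrable
      (hGc.intervalIntegrable 0 t) fun s hs => ?_
    have hs' : s ∈ Icc 0 T := ⟨hs.1, hs.2.trans ht.2⟩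
    rw [hE, indicator_of_mem hs']
    exact hDG s hs'
  have hG0 : ∀ t ∈ Icc 0 T, 0 ≤ G t := fun t ht => (hD0 t ht).trans (hDG t ht)
  have hgr := norm_le_gronwallBound_of_norm_deriv_right_le (f := H) (f' := fun t => b * G t)
    (δ := a) (K := b) (ε := 0) (a := 0) (b := T)
    (fun t _ => (hHd t).continuousAt.continuousWithinAt)
    (fun t _ => (hHd t).hasDerivWithinAt) (by simp [hH, abs_of_nonneg ha]) fun t ht => by
      have ht' := Ico_subset_Icc_self ht
      have := hG0 t ht'
      rw [Real.norm_eq_abs, Real.norm_eq_abs, abs_of_nonneg (by positivity),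
        abs_of_nonneg (this.trans (hGH t ht')), add_zero]
      exact mul_le_mul_of_nonneg_left (hGH t ht') hb
  intro t ht
  have := hgr t ht
  rw [gronwallBound_ε0, sub_zero] at this
  exact (hDG t ht).trans ((hGH t ht).trans ((le_abs_self _).trans this))

section Stability

variable {K T B M : ℝ} {g : ℝ → ℝ} {μ : ℝ → Measure Phase} {γ : Measure ℝ} {ρ : ℝ → Phase → ℝ}

lemma isFiniteMeasure_densityMeasure {X : Type*} [MeasurableSpace X] {m : Measure X} {f : X → ℝ}
    (hf : Integrable f m) : IsFiniteMeasure (densityMeasure m f) :=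
  isFiniteMeasure_withDensity_ofReal hf.hasFiniteIntegral

lemma IsDensitySolution.abs_integral_weight_sub_le (h : IsDensitySolution K T γ ρ)
    [IsFiniteMeasure γ] (hρ : ρ 0 ∈ admissible phaseDist) (hK : 0 ≤ K)
    (hB : 2 * π * γ.real univ ≤ B) (hg : g ∈ admissible fun x y : ℝ => dist x y)
    (hg0 : ∀ ω, 0 ≤ g ω) (hgi : Integrable g) {k k' : Torus → ℝ → ℝ}
    (hk : IsObservable k k' 1 0) {t : ℝ} (ht : t ∈ Icc 0 T) :
    |(∫ p, k p.1 p.2 ∂(weightByMeasure γ (ρ t))) -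
        ∫ p, g p.2 * k p.1 p.2 ∂(densityMeasure volume (ρ t))| ≤
      2 * π * (T * exp (8 * K * B * T) + 1) * freqBL γ (densityMeasure volume g) := by
  have hgc := continuous_of_admissible hg
  have hk1 : ∀ p : Phase, |k p.1 p.2| ≤ 1 := fun p => hk.abs_le_one _ _
  have hT : 0 ≤ T := ht.1.trans ht.2
  have := isFiniteMeasure_densityMeasure hgi
  rw [h.integral_weightByMeasure hρ.1 ht hk.continuous hk1,
    h.integral_eq ht hgc hg.1 hk.continuous hk1]
  have e : ∫ ω, g ω * angularIntegral (fun p => k p.1 p.2 * ρ t p) ω =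
      ∫ ω, angularIntegral (fun p => k p.1 p.2 * ρ t p) ω ∂(densityMeasure volume g) := by
    rw [integral_densityMeasure _ hgc.measurable hg0]
    simp only [mul_comm]
  rw [e]
  have hexp : 0 ≤ T * exp (8 * K * B * T) := by positivity
  refine abs_integral_sub_le_blDist (δ := fun x y : ℝ => dist x y) (by positivity)
    (fun ω => (h.abs_angularIntegral_mul_le hρ.1 ht hk1 ω).trans ?_)
    fun ω ω' => h.angularIntegral_lipschitz hρ hK hB hk ht ω ω'
  exact le_mul_of_one_le_right (by positivity) (by linarith)

lemma IsDensitySolution.abs_integral_freq_mul_sub_le (h : IsDensitySolution K T γ ρ)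
    [IsFiniteMeasure γ] (hρ : ρ 0 ∈ admissible phaseDist) (hK : 0 ≤ K)
    (hB : 2 * π * γ.real univ ≤ B) (hg : g ∈ admissible fun x y : ℝ => dist x y)
    {C S : ℝ → ℝ} (hμ : IsTransported K T B M μ C S) {k k' : Torus → ℝ → ℝ}
    (hk : IsObservable k k' 1 0) {t : ℝ} (ht : t ∈ Icc 0 T) :
    |(∫ p, g p.2 * k p.1 p.2 ∂(densityMeasure volume (ρ t))) -
        ∫ p, g p.2 * k p.1 p.2 ∂(μ t)| ≤
      (2 + exp (8 * K * B * T) + T * exp (8 * K * B * T)) *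
          phaseBL (densityMeasure volume (ρ 0)) (μ 0) +
        exp (8 * K * B * T) * M * (K * ∫ r in (0 : ℝ)..t,
          (|cosMean (weightByMeasure γ (ρ r)) - C r| +
            |sinMean (weightByMeasure γ (ρ r)) - S r|)) := by
  have hT : 0 ≤ T := ht.1.trans ht.2
  have h0 : (0 : ℝ) ∈ Icc 0 T := ⟨le_rfl, hT⟩
  have hB0 : 0 ≤ B := le_trans (by positivity) hB
  have htr := h.isTransported hρ.1 hB
  have hk1 : ∀ p : Phase, |k p.1 p.2| ≤ 1 := fun p => hk.abs_le_one _ _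
  have hν0 := htr.finite 0 h0
  have hνt := htr.finite t ht
  have hμ0 := hμ.finite 0 h0
  have hμt := hμ.finite t ht
  obtain ⟨φ, hφ, hφl, hφg⟩ := exists_freqTest_approx hg
  refine le_of_tendsto' ((tendsto_integral_of_freqTest hφ hφg (densityMeasure volume (ρ t))
    hk.continuous hk1).sub (tendsto_integral_of_freqTest hφ hφg (μ t) hk.continuous hk1)).abs
    fun m => ?_
  obtain ⟨R, hR⟩ := hφ m
  have happ := exists_observable_approx hK hB0
    (integrableOn_Icc_of_bound htr.measurable_cos htr.abs_cos_le)
    (integrableOn_Icc_of_bound htr.measurable_sin htr.abs_sin_le) htr.abs_cos_le htr.abs_sin_le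
    ht hk
  set I := ∫ r in (0 : ℝ)..t, (|cosMean (weightByMeasure γ (ρ r)) - C r| +
    |sinMean (weightByMeasure γ (ρ r)) - S r|)
  set Â := exp (8 * K * B * T)
  have hÂ : 0 ≤ Â := (exp_pos _).le
  set q := (densityMeasure volume (ρ 0)).real univ
  set V := 3 * (|R| + 2 * K * B) ^ 2
  have hlim : Tendsto (fun N : ℕ => 1 * Â * q * (V * (t ^ 2 / N)) +
      (2 + Â + T * Â) * phaseBL (densityMeasure volume (ρ 0)) (μ 0) +
      1 * Â * M * (V * (t ^ 2 / N) + K * I)) atTop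
      (𝓝 ((2 + Â + T * Â) * phaseBL (densityMeasure volume (ρ 0)) (μ 0) +
        Â * M * (K * I))) := by
    have hN := (tendsto_const_div_atTop_nhds_zero_nat (t ^ 2)).const_mul V
    simpa using ((hN.const_mul (1 * Â * q)).add_const
      ((2 + Â + T * Â) * phaseBL (densityMeasure volume (ρ 0)) (μ 0))).add
      ((hN.add_const (K * I)).const_mul (1 * Â * M))
  refine ge_of_tendsto hlim ?_
  filter_upwards [happ] with N hN
  obtain ⟨k₀, k₀', hk₀, hb⟩ := hN
  have b1 := hb _ _ _ _ htr _ _ _ hR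
  simp only [sub_self, abs_zero, add_zero, intervalIntegral.integral_zero, mul_zero] at b1
  have b2 := hb _ _ _ _ hμ _ _ _ hR
  have b3 : |(∫ p, φ m p.2 * k₀ p.1 p.2 ∂(densityMeasure volume (ρ 0))) -
      ∫ p, φ m p.2 * k₀ p.1 p.2 ∂(μ 0)| ≤
      (2 + Â + T * Â) * phaseBL (densityMeasure volume (ρ 0)) (μ 0) := by
    have hTÂ : 0 ≤ T * Â := by positivity
    refine abs_integral_sub_le_blDist (by positivity) (fun p => ?_)
      (abs_freq_mul_observable_sub_le hk₀ hTÂ hR.bound (hφl m))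
    rw [abs_mul]
    exact (mul_le_one₀ (hR.bound _) (abs_nonneg _) (hk₀.abs_le_one _ _)).trans (by linarith)
  have tri : ∀ a b c d : ℝ, |a - b| ≤ |a - c| + |c - d| + |b - d| := fun a b c d => by
    have e : a - b = (a - c) + (c - d) - (b - d) := by ring
    rw [e]
    exact (abs_sub _ _).trans (add_le_add_left (abs_add_le _ _) _)
  exact (tri _ _ _ _).trans (add_le_add (add_le_add b1 b3) b2)

lemma IsDensitySolution.abs_mean_sub_le (h : IsDensitySolution K T γ ρ)
    [IsFiniteMeasure γ] (hρ : ρ 0 ∈ admissible phaseDist) (hK : 0 ≤ K)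
    (hB : 2 * π * γ.real univ ≤ B) (hg : g ∈ admissible fun x y : ℝ => dist x y)
    (hg0 : ∀ ω, 0 ≤ g ω) (hgi : Integrable g)
    (hμ : IsTransported K T B M μ (fun t => cosMean (weightByDensity g (μ t)))
      (fun t => sinMean (weightByDensity g (μ t)))) {t : ℝ} (ht : t ∈ Icc 0 T) :
    |cosMean (weightByMeasure γ (ρ t)) - cosMean (weightByDensity g (μ t))| +
        |sinMean (weightByMeasure γ (ρ t)) - sinMean (weightByDensity g (μ t))| ≤
      2 * (2 * π * (T * exp (8 * K * B * T) + 1) + (2 + exp (8 * K * B * T) +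
          T * exp (8 * K * B * T))) * (freqBL γ (densityMeasure volume g) +
          phaseBL (densityMeasure volume (ρ 0)) (μ 0)) *
        exp (2 * (exp (8 * K * B * T) * M * K) * T) := by
  have hT : 0 ≤ T := ht.1.trans ht.2
  have htr := h.isTransported hρ.1 hB
  have hM : 0 ≤ M := measureReal_nonneg.trans (hμ.mass_le t ht)
  set Â := exp (8 * K * B * T)
  have hÂ : 0 ≤ Â := (exp_pos _).le
  have hd1 : 0 ≤ freqBL γ (densityMeasure volume g) := blDist_nonneg _ _ _
  have hd2 : 0 ≤ phaseBL (densityMeasure volume (ρ 0)) (μ 0) := blDist_nonneg _ _ _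
  set d1 := freqBL γ (densityMeasure volume g)
  set d2 := phaseBL (densityMeasure volume (ρ 0)) (μ 0)
  set D : ℝ → ℝ := fun r => |cosMean (weightByMeasure γ (ρ r)) - cosMean (weightByDensity g (μ r))| +
    |sinMean (weightByMeasure γ (ρ r)) - sinMean (weightByDensity g (μ r))| with hD
  have hDi : IntegrableOn D (Icc 0 T) :=
    ((integrableOn_Icc_of_bound htr.measurable_cos htr.abs_cos_le).sub
      (integrableOn_Icc_of_bound hμ.measurable_cos hμ.abs_cos_le)).abs.add
    ((integrableOn_Icc_of_bound htr.measurable_sin htr.abs_sin_le).sub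
      (integrableOn_Icc_of_bound hμ.measurable_sin hμ.abs_sin_le)).abs
  have single : ∀ (k : Torus → ℝ) (k' : Torus → ℝ → ℝ), IsObservable (fun θ _ => k θ) k' 1 0 →
      ∀ s ∈ Icc 0 T, |(∫ p : Phase, k p.1 ∂(weightByMeasure γ (ρ s))) -
        ∫ p : Phase, k p.1 ∂(weightByDensity g (μ s))| ≤
        2 * π * (T * Â + 1) * d1 + ((2 + Â + T * Â) * d2 +
          Â * M * (K * ∫ r in (0 : ℝ)..s, D r)) := fun k k' hk s hs => by
    have b1 := h.abs_integral_weight_sub_le hρ hK hB hg hg0 hgi hk hs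
    have b2 := h.abs_integral_freq_mul_sub_le hρ hK hB hg hμ hk hs
    rw [integral_weightByDensity hg hg0]
    exact (abs_sub_le _ _ _).trans (add_le_add b1 b2)
  have main : ∀ s ∈ Icc 0 T, D s ≤ 2 * (2 * π * (T * Â + 1) + (2 + Â + T * Â)) * (d1 + d2) +
      2 * (Â * M * K) * ∫ r in (0 : ℝ)..s, D r := fun s hs => by
    have c1 := single _ _ isObservable_cos s hs
    have c2 := single _ _ isObservable_sin s hs
    have c3 : 0 ≤ 2 * π * (T * Â + 1) * d2 := by positivity
    have c4 : 0 ≤ (2 + Â + T * Â) * d1 := by positivity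
    refine (add_le_add c1 c2).trans ?_
    linarith
  have hgr := le_exp_of_le_integral hDi (by positivity) (by positivity)
    (fun s _ => by positivity) main t ht
  refine hgr.trans (mul_le_mul_of_nonneg_left (Real.exp_le_exp.2
    (mul_le_mul_of_nonneg_left ht.2 (by positivity))) (by positivity))

lemma freq_mass_le [IsFiniteMeasure γ] (hgc : Continuous g) (hg0 : ∀ ω, 0 ≤ g ω)
    (hgi : Integrable g) (hg1 : ∫ ω, g ω = 1) :
    γ.real univ ≤ 1 + freqBL γ (densityMeasure volume g) := by
  have := isFiniteMeasure_densityMeasure hgi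
  have h1 := abs_integral_sub_le_blDist (μ := γ) (ν := densityMeasure volume g)
    (δ := fun x y : ℝ => dist x y) (f := fun _ => 1) (L := 1) one_pos (by simp)
    (fun x y => by simp)
  rw [integral_densityMeasure _ hgc.measurable hg0] at h1
  simp only [one_mul, hg1, integral_const, smul_eq_mul, mul_one] at h1
  have := (abs_le.1 h1).2
  rw [freqBL]
  linarith

end Stability

/-- Lipschitz stability of the order parameter with respect to the frequency distribution and the
initial datum. -/
lemma exists_orderParameter_stability (K T M : ℝ) (hK : 0 < K) (hT : 0 ≤ T) :
    ∃ C : ℝ, 0 < C ∧ ∀ (g : ℝ → ℝ) (μ : ℝ → Measure Phase),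
      g ∈ admissible (fun x y : ℝ => dist x y) → (∀ ω, 0 ≤ g ω) → Integrable g → ∫ ω, g ω = 1 →
      IsMeasureSolution K T g μ → (μ 0).real univ ≤ M →
      ∀ (γ : Measure ℝ) (ρ : ℝ → Phase → ℝ), IsFiniteMeasure γ → ρ 0 ∈ admissible phaseDist →
      IsDensitySolution K T γ ρ → ∀ t ∈ Icc 0 T,
        |orderParameter (weightByMeasure γ (ρ t)) - orderParameter (weightByDensity g (μ t))| ≤
          C * (freqBL γ (densityMeasure volume g) +
            phaseBL (densityMeasure volume (ρ 0)) (μ 0)) := by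
  set B := |M| + 4 * π with hB
  have hB0 : 0 ≤ B := by positivity
  set Â := exp (8 * K * B * T)
  set C₁ := 2 * (2 * π * (T * Â + 1) + (2 + Â + T * Â)) * exp (2 * (Â * |M| * K) * T) with hC₁
  have hC₁0 : 0 < C₁ := by positivity
  refine ⟨C₁ + (4 * π + |M|), by positivity, ?_⟩
  intro g μ hg hg0 hgi hg1 hμ hM γ ρ hγ hρ h t ht
  have hd1 : 0 ≤ freqBL γ (densityMeasure volume g) := blDist_nonneg _ _ _
  have hd2 : 0 ≤ phaseBL (densityMeasure volume (ρ 0)) (μ 0) := blDist_nonneg _ _ _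
  have hmass := freq_mass_le (γ := γ) (continuous_of_admissible hg) hg0 hgi hg1
  have hfinμ := hμ.finite t ht
  have hfin1 := h.isFiniteMeasure_weight hρ.1 ht
  have hfin2 := isFiniteMeasure_weightByDensity hg (μ t)
  set d1 := freqBL γ (densityMeasure volume g)
  set d2 := phaseBL (densityMeasure volume (ρ 0)) (μ 0)
  have hMabs := le_abs_self M
  have hMnn := abs_nonneg M
  rcases le_or_gt d1 1 with hd | hd
  · have hBγ : 2 * π * γ.real univ ≤ B := by
      have : 2 * π * γ.real univ ≤ 2 * π * 2 :=
        mul_le_mul_of_nonneg_left (by linarith) Real.two_pi_pos.le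
      rw [hB]; linarith
    have htrμ := hμ.isTransported (M := |M|) (B := B) hg hg0 (hM.trans hMabs)
      (by rw [hB]; linarith [Real.pi_pos])
    have key := h.abs_mean_sub_le hρ hK.le hBγ hg hg0 hgi htrμ ht
    refine (abs_orderParameter_sub_le _ _).trans (key.trans ?_)
    have e : 2 * (2 * π * (T * Â + 1) + (2 + Â + T * Â)) * (d1 + d2) *
        exp (2 * (Â * |M| * K) * T) = C₁ * (d1 + d2) := by rw [hC₁]; ring
    rw [e]
    exact mul_le_mul_of_nonneg_right (by linarith [Real.pi_pos]) (by positivity)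
  · have o1 := (orderParameter_le (weightByMeasure γ (ρ t))).trans (h.weight_univ_le hρ.1 ht)
    have o2 := (orderParameter_le (weightByDensity g (μ t))).trans
      ((weightByDensity_univ_le hg hg0 (μ t)).trans
        ((IsWeakSolution.measure_univ_eq hμ ht).trans_le (hM.trans hMabs)))
    have o3 : 2 * π * γ.real univ ≤ 2 * π * (2 * d1) :=
      mul_le_mul_of_nonneg_left (by linarith) Real.two_pi_pos.le
    have o4 : |M| ≤ |M| * d1 := le_mul_of_one_le_right hMnn hd.le
    have o5 : |orderParameter (weightByMeasure γ (ρ t)) - orderParameter (weightByDensity g (μ t))| ≤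
        (4 * π + |M|) * d1 := by
      have p1 := orderParameter_nonneg (weightByMeasure γ (ρ t))
      have p2 := orderParameter_nonneg (weightByDensity g (μ t))
      rw [abs_le]
      constructor <;> linarith
    have o6 : 0 ≤ C₁ * (d1 + d2) := by positivity
    have o7 : 0 ≤ (4 * π + |M|) * d2 := by positivity
    linarith

end

end Kuramoto

theorem mainTheorem5 (K T M : ℝ) (hK : 0 < K) (hT : 0 ≤ T) :
    ∃ C : ℝ, 0 < C ∧
      ∀ (g : ℝ → ℝ) (μ : ℝ → Measure Kuramoto.Phase),
        g ∈ Kuramoto.admissible (fun x y : ℝ => dist x y) → (∀ ω, 0 ≤ g ω) →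
        Integrable g → ∫ ω, g ω = 1 →
        Kuramoto.IsMeasureSolution K T g μ → (μ 0).real univ ≤ M →
      ∀ (γ : ℕ → Measure ℝ) (ρ : ℕ → ℝ → Kuramoto.Phase → ℝ),
        (∀ n, IsFiniteMeasure (γ n)) →
        (∀ n, ρ n 0 ∈ Kuramoto.admissible Kuramoto.phaseDist) →
        (∀ n, Kuramoto.IsDensitySolution K T (γ n) (ρ n)) →
        (∀ n, ∀ t ∈ Icc 0 T,
          |Kuramoto.orderParameter (Kuramoto.weightByMeasure (γ n) (ρ n t)) -
              Kuramoto.orderParameter (Kuramoto.weightByDensity g (μ t))| ≤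
            C * (Kuramoto.freqBL (γ n) (Kuramoto.densityMeasure volume g) +
              Kuramoto.phaseBL (Kuramoto.densityMeasure volume (ρ n 0)) (μ 0))) ∧
        (Tendsto (fun n => Kuramoto.freqBL (γ n) (Kuramoto.densityMeasure volume g))
            atTop (𝓝 0) →
          Tendsto (fun n =>
            Kuramoto.phaseBL (Kuramoto.densityMeasure volume (ρ n 0)) (μ 0)) atTop (𝓝 0) →
          ∀ t ∈ Icc 0 T, Tendsto
            (fun n => Kuramoto.orderParameter (Kuramoto.weightByMeasure (γ n) (ρ n t))) atTop
            (𝓝 (Kuramoto.orderParameter (Kuramoto.weightByDensity g (μ t))))) := by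
  obtain ⟨C, hC, hstab⟩ := Kuramoto.exists_orderParameter_stability K T M hK hT
  refine ⟨C, hC, fun g μ hg hg0 hgi hg1 hμ hM γ ρ hγ hρ h => ?_⟩
  have hbound := fun n => hstab g μ hg hg0 hgi hg1 hμ hM (γ n) (ρ n) (hγ n) (hρ n) (h n)
  refine ⟨hbound, fun hfreq hphase t ht => ?_⟩
  refine tendsto_iff_dist_tendsto_zero.2
    (squeeze_zero (fun _ => dist_nonneg) (fun n => hbound n t ht) ?_)
  simpa using (hfreq.add hphase).const_mul C
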